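/- Setting. Let $\{(G_\lambda,d_\lambda)\}_{\lambda\in\Lambda}$, $\Lambda\neq\emptyset$, be groups with two-sided invariant metrics and a common closed subgroup $A$, with $G_{\lambda_1}\cap G_{\lambda_2}=A$ for $\lambda_1\ne\lambda_2$, such that all $d_\lambda$ agree on $A$. Let $G=\bigcup_\lambda G_\lambda$, and let $P=\coprod_A G_\lambda$ be the free product with amalgamation over $A$. Write $g\cong h$ (multipliable) if $g,h\in G_\lambda$ for some $\lambda$. On $G$ let $d=d_\lambda$ on each $G_\lambda$ and $d(g,h)=\inf_{a\in A}\{d_{\lambda_1}(g,a)+d_{\lambda_2}(a,h)\}$ if $g\in G_{\lambda_1}$, $h\in G_{\lambda_2}$ are not multipliable. A word is a finite nonempty sequence $\alpha=\alpha(1)\cdots\alpha(n)$ of letters of $G$; $\hat\alpha\in P$ is the product of its letters, and for $F\subseteq\{1,\dots,n\}$, $\hat\alpha[F]$ is the product of the letters $\alpha(i)$, $i\in F$, in increasing order of $i$. For words of the same length $n$ put $\rho(\alpha,\beta)=\sum_{i=1}^n d(\alpha(i),\beta(i))$. The Graev metric is $\underline d(f_1,f_2)=\inf\{\rho(\alpha_1,\alpha_2):|\alpha_1|=|\alpha_2|,\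 \hat\alpha_i=f_i\}$ and the Graev norm is $N(f)=\underline d(f,e)$. A word $\alpha$ is a reduced form of $f$ if $\hat\alpha=f$ and $\alpha(i)\not\cong\alpha(i+1)$ for all $i<|\alpha|$. An $f$-pair is a pair of words $(\alpha,\zeta)$ of the same length with $\hat\alpha=f$, $\hat\zeta=e$; it is multipliable if $\alpha(i)\cong\zeta(i)$ for all $i$. In a rooted tree write $s\prec t$ if $s\neq t$ and $t$ lies on the path from $s$ to the root, and $H$ for the distance to the root. A slim evaluation tree for a word $\zeta$ of length $n$ with $\hat\zeta=e$ is a rooted tree $T$ with a nonempty interval $I_t\subseteq\{1,\dots,n\}$ assigned to each node $t$ such that, with $R_t=I_t\setminus\bigcup_{s\prec t}I_s$: $I_{\mathrm{root}}=\{1,\dots,n\}$; $\hat\zeta[I_t]=e$; if $H(t)\le H(s)$ and $I_s\cap I_t\ne\emptyset$ then $s\prec t$ or $s=t$; if $s\prec t$ and $t$ is not the root then $\min I_t<\min I_s$ and $\max I_s<\max I_t$; and $\zeta(i)\cong\zeta(j)$ for all $i,j\in R_t$. A multipliable $f$-pair $(\alpha,\zeta)$ is symmetric if $\zeta$ has a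 slim evaluation tree $T$ such that for each node $t$ there are $i_1<\dots<i_m$ in $R_t$ ($m\ge1$), with $\zeta(i)=e$ for all $i\in R_t\setminus\{i_1,\dots,i_m\}$ and $\alpha(i_k)\cong\alpha(i_l)$ for all $k,l$, and an index $k_0$ such that either $m=1$, or $\zeta(i_k)=\alpha(i_k)$ for all $k\ne k_0$ and \[\zeta(i_{k_0})=\alpha(i_{k_0-1})^{-1}\cdots\alpha(i_1)^{-1}\cdot\alpha(i_m)^{-1}\cdots\alpha(i_{k_0+1})^{-1}.\] It is a symmetric reduced $f$-pair if moreover $\alpha$ is a reduced form of $f$. Theorem. For every $f\in P$, \[N(f)=\inf\{\rho(\alpha,\xi):(\alpha,\xi)\text{ is a symmetric reduced }f\text{-pair}\},\] and the set on the right is nonempty. If $A=\{e\}$, then moreover $f$ has exactly one reduced form $\alpha$; there are only finitely many symmetric reduced $f$-pairs; the infimum is attained, that is, \[N(f)=\min\{\rho(\alpha,\xi):(\alpha,\xi)\text{ is a symmetric reduced }f\text{-pair}\};\] and in each symmetric reduced $f$-pair $(\alpha,\xi)$ every letter of $\xi$ is built from the letters of $\alpha$: $\xi(k)$ is $e$,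 or $\alpha(k)$, or $\hat\alpha[F_{<k}]^{-1}\,\hat\alpha[F_{>k}]^{-1}$ for some $F\subseteq\{1,\dots,|\alpha|\}$, where $F_{<k}=\{i\in F:i<k\}$ and $F_{>k}=\{i\in F:i>k\}$. -/

import Mathlib

open Monoid

noncomputable section

namespace Graev

/-! ### Letters and words

`Monoid.PushoutI φ` is the free product of the groups `G i` with amalgamation over `A`, where
`φ i : A →* G i` are injective homomorphisms.  Then every `G i` embeds in it through
`PushoutI.of i`, `A` embeds through `PushoutI.base φ`, and the images of two different `G i` meet
exactly in the image of `A`.  The union `⋃ i, G i` is realised as the set `letters φ`. -/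

section Words

variable {ι A : Type*} {G : ι → Type*} [Group A] [∀ i, Group (G i)] (φ : ∀ i, A →* G i)

/-- The union of the factors `G i`, inside the amalgam. -/
def letters : Set (PushoutI φ) := {x | ∃ i, x ∈ (PushoutI.of (φ := φ) i).range}

/-- The amalgamated subgroup `A`, inside the amalgam. -/
def amalg : Subgroup (PushoutI φ) := (PushoutI.base φ).range

/-- Two letters are multipliable if they lie in a common factor. -/
def Multipliable (x y : PushoutI φ) : Prop :=
  ∃ i, x ∈ (PushoutI.of (φ := φ) i).range ∧ y ∈ (PushoutI.of (φ := φ) i).range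

/-- A (nonempty) word of length `n` over the alphabet `⋃ i, G i`. -/
def IsWord {n : ℕ} (α : Fin n → PushoutI φ) : Prop := 0 < n ∧ ∀ k, α k ∈ letters φ

/-- The value in the group of a word. -/
def eval {P : Type*} [Group P] {n : ℕ} (α : Fin n → P) : P := (List.ofFn α).prod

/-- The value of the subword of `α` at the positions in `F`: the product of the `α k`, `k ∈ F`,
in increasing order of `k`. -/
def evalOn {P : Type*} [Group P] {n : ℕ} (α : Fin n → P) (F : Finset (Fin n)) : P :=
  (F.sort.map α).prod

/-- A word is reduced if no two consecutive letters are multipliable. -/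
def IsReduced {n : ℕ} (α : Fin n → PushoutI φ) : Prop :=
  ∀ k l : Fin n, (k : ℕ) + 1 = l → ¬ Multipliable φ (α k) (α l)

/-- `α` is a reduced form of `f`. -/
def IsReducedForm (f : PushoutI φ) {n : ℕ} (α : Fin n → PushoutI φ) : Prop :=
  IsWord φ α ∧ IsReduced φ α ∧ eval α = f

/-- `(α, ζ)` is an `f`-pair: words of the same length with values `f` and `1`. -/
def IsPair (f : PushoutI φ) {n : ℕ} (α ζ : Fin n → PushoutI φ) : Prop :=
  IsWord φ α ∧ IsWord φ ζ ∧ eval α = f ∧ eval ζ = 1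

/-- `(α, ζ)` is a multipliable `f`-pair. -/
def IsMultipliablePair (f : PushoutI φ) {n : ℕ} (α ζ : Fin n → PushoutI φ) : Prop :=
  IsPair φ f α ζ ∧ ∀ k, Multipliable φ (α k) (ζ k)

end Words

/-! ### Trees -/

/-- A rooted tree, given by the map that sends each node to its parent (and the root to itself);
the edges go from each node other than the root to its parent. -/
structure Tree where
  Node : Type
  root : Node
  parent : Node → Node
  parent_root : parent root = root
  reaches_root : ∀ t, ∃ k : ℕ, parent^[k] t = root

namespace Tree

/-- The distance of a node to the root. -/
def height (T : Tree) (t : T.Node) : ℕ := sInf {k : ℕ | T.parent^[k] t = T.root}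

/-- `T.Below s t`: there is a directed path (of positive length) from `s` to `t`, so that `t` is
nearer to the root. -/
def Below (T : Tree) (s t : T.Node) : Prop := s ≠ t ∧ ∃ k : ℕ, T.parent^[k] s = t

end Tree

/-! ### Evaluation trees -/

/-- A tree with a nonempty interval `[lo t, hi t]` of positions assigned to each node `t`. -/
structure IntervalTree (n : ℕ) extends Tree where
  lo : Node → Fin n
  hi : Node → Fin n
  lo_le_hi : ∀ t, lo t ≤ hi t

namespace IntervalTree

variable {n : ℕ} (T : IntervalTree n)

/-- The interval at the node `t`. -/
def I (t : T.Node) : Finset (Fin n) := Finset.Icc (T.lo t) (T.hi t)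

/-- The positions in the interval at `t` that are in no interval at a node below `t`. -/
def R (t : T.Node) : Set (Fin n) := {k | k ∈ T.I t ∧ ∀ s, T.Below s t → k ∉ T.I s}

end IntervalTree

section Trees

variable {ι A : Type*} {G : ι → Type*} [Group A] [∀ i, Group (G i)] (φ : ∀ i, A →* G i)

/-- `T` is an evaluation tree for the trivial word `ζ` (with the canonical labels, for which the
usual condition on the labels of the endpoints is void). -/
structure IsEvaluationTree {n : ℕ} (ζ : Fin n → PushoutI φ) (T : IntervalTree n) : Prop where
  isWord : IsWord φ ζ
  trivial : eval ζ = 1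
  root_interval : T.I T.root = Finset.univ
  eval_mem : ∀ t, evalOn ζ (T.I t) ∈ amalg φ
  order : ∀ s t, T.height t ≤ T.height s → (T.I s ∩ T.I t).Nonempty → T.Below s t ∨ s = t
  strict : ∀ s t, T.Below s t → t ≠ T.root → T.lo t < T.lo s ∧ T.hi s < T.hi t
  multipliable : ∀ t, ∀ k ∈ T.R t, ∀ l ∈ T.R t, Multipliable φ (ζ k) (ζ l)

/-- A slim evaluation tree: each interval has value `1`. -/
def IsSlimTree {n : ℕ} (ζ : Fin n → PushoutI φ) (T : IntervalTree n) : Prop :=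
  IsEvaluationTree φ ζ T ∧ ∀ t, evalOn ζ (T.I t) = 1

/-- The list of positions `F` (increasing) is symmetrization admissible at the node `t`. -/
def IsAdmissible {n : ℕ} (α ζ : Fin n → PushoutI φ) (T : IntervalTree n) (t : T.Node)
    (F : Finset (Fin n)) : Prop :=
  (∀ k ∈ F, k ∈ T.R t) ∧ (∀ k ∈ T.R t, ζ k ≠ 1 → k ∈ F) ∧
    ∀ k ∈ F, ∀ l ∈ F, Multipliable φ (α k) (α l)

/-- The symmetrization of `ζ` along the list `F = {i₁ < … < iₘ}` at the position `j = iₖ ∈ F`: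
the letters at positions in `F` other than `j` are replaced by those of `α`, and the letter at `j`
by `α(iₖ₋₁)⁻¹ ⋯ α(i₁)⁻¹ α(iₘ)⁻¹ ⋯ α(iₖ₊₁)⁻¹`; if `m = 1`, nothing is changed. -/
def symmetrization {P : Type*} [Group P] {n : ℕ} (α ζ : Fin n → P) (j : Fin n)
    (F : Finset (Fin n)) : Fin n → P :=
  if F.card = 1 then ζ else fun k =>
    if k = j then
      (evalOn α (F.filter (· < j)))⁻¹ * (evalOn α (F.filter (j < ·)))⁻¹
    else if k ∈ F then α k
    else ζ k

/-- `(α, ζ)` is a symmetric `f`-pair with respect to the slim evaluation tree `T`. -/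
def IsSymmetricWith (f : PushoutI φ) {n : ℕ} (α ζ : Fin n → PushoutI φ) (T : IntervalTree n) :
    Prop :=
  IsMultipliablePair φ f α ζ ∧ IsSlimTree φ ζ T ∧
    ∀ t, ∃ F : Finset (Fin n), IsAdmissible φ α ζ T t F ∧
      ∃ j ∈ F, ζ = symmetrization α ζ j F

/-- `(α, ζ)` is a symmetric `f`-pair. -/
def IsSymmetricPair (f : PushoutI φ) {n : ℕ} (α ζ : Fin n → PushoutI φ) : Prop :=
  ∃ T : IntervalTree n, IsSymmetricWith φ f α ζ T

/-- A word of unspecified length. -/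
abbrev Word (P : Type*) := Σ n : ℕ, (Fin n → P)

/-- A pair of words of the same, unspecified, length. -/
abbrev WordPair (P : Type*) := Σ n : ℕ, (Fin n → P) × (Fin n → P)

/-- The set of symmetric reduced `f`-pairs: the symmetric `f`-pairs `(α, ξ)` such that `α` is a
reduced form of `f`. -/
def symmetricReducedPairs (f : PushoutI φ) : Set (WordPair (PushoutI φ)) :=
  {p | IsSymmetricPair φ f p.2.1 p.2.2 ∧ IsReducedForm φ f p.2.1}

end Trees

/-! ### The Graev metric -/

section Metric

variable {ι A : Type*} {G : ι → Type*} [Group A] [∀ i, Group (G i)] [∀ i, MetricSpace (G i)]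
  (φ : ∀ i, A →* G i)

open Classical in
/-- The amalgam metric on the union of the factors: in a common factor it is the metric of that
factor (the first set has exactly one element then), otherwise it is the infimum of the lengths of
the two-step paths through `A`. -/
def letterDist (x y : PushoutI φ) : ℝ :=
  if Multipliable φ x y then
    sInf {r | ∃ i, ∃ g h : G i, PushoutI.of i g = x ∧ PushoutI.of i h = y ∧ r = dist g h}
  else
    sInf {r | ∃ i j, ∃ (g : G i) (h : G j) (a : A), PushoutI.of i g = x ∧ PushoutI.of j h = y ∧
      r = dist g (φ i a) + dist (φ j a) h}

/-- The distance `ρ` of two words of the same length. -/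
def rho {n : ℕ} (α β : Fin n → PushoutI φ) : ℝ := ∑ k, letterDist φ (α k) (β k)

/-- The Graev metric on the amalgam. -/
def graevDist (f₁ f₂ : PushoutI φ) : ℝ :=
  sInf {r | ∃ (n : ℕ) (α₁ α₂ : Fin n → PushoutI φ), IsWord φ α₁ ∧ IsWord φ α₂ ∧
    eval α₁ = f₁ ∧ eval α₂ = f₂ ∧ r = rho φ α₁ α₂}

/-- The Graev norm. -/
def graevNorm (f : PushoutI φ) : ℝ := graevDist φ f 1

/-- In a common factor the amalgam metric is the metric of that factor. -/
theorem letterDist_of (hφ : ∀ i, Function.Injective (φ i))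
    (hagree : ∀ i j a b, dist (φ i a) (φ i b) = dist (φ j a) (φ j b)) (i : ι) (g h : G i) :
    letterDist φ (PushoutI.of i g) (PushoutI.of i h) = dist g h := by
  have hm : Multipliable φ (PushoutI.of i g) (PushoutI.of i h) := ⟨i, ⟨g, rfl⟩, ⟨h, rfl⟩⟩
  rw [letterDist, if_pos hm]
  have : {r | ∃ j, ∃ g' h' : G j, PushoutI.of (φ := φ) j g' = PushoutI.of i g ∧
      PushoutI.of (φ := φ) j h' = PushoutI.of i h ∧ r = dist g' h'} = {dist g h} := by
    ext r
    constructor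
    · rintro ⟨j, g', h', hg, hh, rfl⟩
      by_cases hij : i = j
      · subst hij
        rw [Set.mem_singleton_iff, PushoutI.of_injective hφ i hg, PushoutI.of_injective hφ i hh]
      · have key : ∀ (x : G i) (y : G j), PushoutI.of (φ := φ) j y = PushoutI.of i x →
            ∃ a, φ i a = x ∧ φ j a = y := by
          intro x y hxy
          have hx : PushoutI.of (φ := φ) i x ∈ (PushoutI.base φ).range := by
            rw [← PushoutI.inf_of_range_eq_base_range hφ hij]
            exact ⟨⟨x, rfl⟩, ⟨y, hxy⟩⟩
          obtain ⟨a, ha⟩ := hx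
          refine ⟨a, PushoutI.of_injective hφ i ?_, PushoutI.of_injective hφ j ?_⟩
          · rw [PushoutI.of_apply_eq_base, ha]
          · rw [PushoutI.of_apply_eq_base, ha, hxy]
        obtain ⟨a, rfl, rfl⟩ := key g g' hg
        obtain ⟨b, rfl, rfl⟩ := key h h' hh
        exact hagree j i a b
    · rintro rfl
      exact ⟨i, g, h, rfl, rfl, rfl⟩
  rw [this, csInf_singleton]

end Metric

end Graev

end

open Monoid

noncomputable section

namespace Graev


/-! ### Noncrossing foldings of lists of letters, and surgery on them -/

section FoldCost

variable {ι : Type*} {G : ι → Type*} [∀ i, Group (G i)] [∀ i, MetricSpace (G i)]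

/-! The norm is computed by foldings. A folding is a list of letters with value `f` and a
noncrossing partition of its positions into blocks inside single factors. Its cost is the sum of the
distances from 1 of the block products. Every pair of words `α`, `β` with values `f` and 1 gives a
folding of almost the cost `rho φ α β`: `f` is the value of `α` times the inverse of that of `β`,
which telescopes into conjugates of the `α k * (β k)⁻¹`. Conjugating by a letter `x` is free, since
`x` and `x⁻¹` form one block of product 1 (`foldBound_rho`).

The core is `FoldCost.reduce_tail`: as long as the list behind the head is not in normal form, the
list can be shortened without changing its value or the factor of its head and without raising the
cost. Letters of `A` are pushed into other letters and neighbours in one factor are multiplied;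
biinvariance of the metrics and their agreement on `A` let the folding follow these moves. The
process ends in a normal list, whose letters are a reduced form of `f`.

A folding of a reduced form is a symmetric pair in disguise. In each block keep all letters but the
first, and replace the first by the inverse of the product of the others; by right invariance it
moves exactly as far as the block product is from 1 (`FoldCost.exists_labelled`). The blocks, nested
by their spans, form a slim evaluation tree (`Noncrossing.isSymmetricPair`). Conversely a symmetric
pair is one of the pairs over which the norm is an infimum.

If `A` is trivial, the normal form theorem for free products makes the reduced form unique, and the
symmetrization at the node to which a position belongs leaves finitely many values for the letter
there (`IsSymmetricPair.letter`). So the infimum is over a finite set. -/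

/-- A list of letters of the factors `G i` folds up at cost at most `c`: its positions have a
noncrossing partition into blocks of letters of one factor, such that the distances to `1` of the
products of the blocks add up to at most `c`. -/
inductive FoldCost : List (Σ i, G i) → ℝ → Prop
  | nil {c : ℝ} (hc : 0 ≤ c) : FoldCost [] c
  | sing {i : ι} (x : G i) {v : List (Σ i, G i)} {c e : ℝ} (hv : FoldCost v c)
      (he : dist x 1 + c ≤ e) : FoldCost (⟨i, x⟩ :: v) e
  | join {i : ι} (x y : G i) {u v : List (Σ i, G i)} {c d e : ℝ} (hu : FoldCost u c)
      (hv : FoldCost (⟨i, x * y⟩ :: v) d) (he : c + d ≤ e) :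
      FoldCost (⟨i, x⟩ :: (u ++ ⟨i, y⟩ :: v)) e

namespace FoldCost

theorem mono {w : List (Σ i, G i)} {c d : ℝ} (h : FoldCost w c) (hcd : c ≤ d) : FoldCost w d := by
  cases h with
  | nil hc => exact .nil (hc.trans hcd)
  | sing x hv he => exact .sing x hv (he.trans hcd)
  | join x y hu hv he => exact .join x y hu hv (he.trans hcd)

theorem nonneg {w : List (Σ i, G i)} {c : ℝ} (h : FoldCost w c) : 0 ≤ c := by
  induction h with
  | nil hc => exact hc
  | sing x _ he ih => exact (add_nonneg dist_nonneg ih).trans he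
  | join x y _ _ he ih₁ ih₂ => exact (add_nonneg ih₁ ih₂).trans he

theorem single {i : ι} (x : G i) : FoldCost [⟨i, x⟩] (dist x 1) :=
  .sing x (.nil le_rfl) (by simp)

theorem dist_le {i : ι} {x : G i} {c : ℝ} (h : FoldCost [⟨i, x⟩] c) : dist x 1 ≤ c := by
  generalize hw : [(⟨i, x⟩ : Σ i, G i)] = w at h
  cases h with
  | nil => cases hw
  | sing y hv he =>
    cases hw
    exact (le_add_of_nonneg_right hv.nonneg).trans he
  | join y z hu hv he => simp at hw

theorem append {u v : List (Σ i, G i)} {c d : ℝ} (hu : FoldCost u c) (hv : FoldCost v d) :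
    FoldCost (u ++ v) (c + d) := by
  induction hu with
  | nil hc => exact hv.mono (by linarith)
  | sing x _ he ih => exact .sing x ih (by linarith)
  | join x y hu _ he _ ih =>
    rw [List.cons_append, List.append_assoc]
    exact .join x y hu ih (by linarith)

/-- A folding list may be inserted anywhere. -/
theorem insert {u w : List (Σ i, G i)} {c d : ℝ} (hu : FoldCost u c) (hw : FoldCost w d) :
    ∀ p q, w = p ++ q → FoldCost (p ++ (u ++ q)) (c + d) := by
  induction hw with
  | nil hc =>
    intro p q h
    obtain ⟨rfl, rfl⟩ := List.append_eq_nil_iff.1 h.symm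
    simpa using hu.mono (by linarith)
  | sing x hv he ih =>
    intro p q h
    cases p with
    | nil => subst h; exact hu.append (.sing x hv he)
    | cons s p =>
      cases h
      exact .sing x (ih p q rfl) (by linarith)
  | @join i x y u' v c' d' e hu' hv he ih₁ ih₂ =>
    intro p q h
    cases p with
    | nil => subst h; exact hu.append (.join x y hu' hv he)
    | cons s p =>
      obtain ⟨rfl, h'⟩ := List.cons_eq_cons.1 h
      -- The cut lies behind the closing letter `y`, just before it, or inside `u'`. The first case
      -- is handled in the merged list, the last in the inner folding.
      rcases List.append_eq_append_iff.1 h' with ⟨a, rfl, hs⟩ | ⟨a, rfl, rfl⟩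
      · cases a with
        | nil =>
          subst hs
          have := FoldCost.join x y (hu'.append hu) hv (e := c + e) (by linarith)
          simpa using this
        | cons t a =>
          cases hs
          have := FoldCost.join x y hu' (ih₂ (⟨i, x * y⟩ :: a) q rfl) (e := c + e) (by linarith)
          simpa using this
      · have := FoldCost.join x y (ih₁ p a rfl) hv (e := c + e) (by linarith)
        simpa using this

/-- A letter may be split into two, with a folding list between them. -/
theorem split {w : List (Σ i, G i)} {c : ℝ} (hw : FoldCost w c) :
    ∀ (p q u : List (Σ i, G i)) (i : ι) (x y : G i) (d : ℝ), FoldCost u d →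
      w = p ++ ⟨i, x * y⟩ :: q → FoldCost (p ++ ⟨i, x⟩ :: (u ++ ⟨i, y⟩ :: q)) (d + c) := by
  induction hw with
  | nil hc => intro p q u i x y d hd h; simp at h
  | @sing j z v c e hv he ih =>
    intro p q u i x y d hd h
    cases p with
    | nil =>
      cases h
      exact .join x y hd (.sing _ hv he) le_rfl
    | cons s p =>
      cases h
      exact .sing z (ih p q u i x y d hd rfl) (by linarith)
  | @join j z z' u' v c' d' e hu hv he ih₁ ih₂ =>
    intro p q u i x y d hd h
    have key : ∀ (x y : G j) {d : ℝ} {u}, FoldCost u d → z' = x * y →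
        FoldCost (⟨j, z⟩ :: (u' ++ ⟨j, x⟩ :: (u ++ ⟨j, y⟩ :: v))) (d + e) := by
      rintro x y d u hd rfl
      -- The split letter is the closing one: its block is now closed in two stages, first at `x`,
      -- then at `y`.
      refine .join z x hu (.join (z * x) y hd ?_ le_rfl) (by linarith : c' + (d + d') ≤ _)
      rwa [mul_assoc]
    cases p with
    | nil =>
      cases h
      exact .join x y hd (.join _ z' hu hv he) le_rfl
    | cons s p =>
      obtain ⟨rfl, h'⟩ := List.cons_eq_cons.1 h
      rcases List.append_eq_append_iff.1 h' with ⟨a, rfl, hs⟩ | ⟨a, rfl, hs⟩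
      · cases a with
        | nil =>
          cases hs
          simpa using key x y hd rfl
        | cons t a =>
          cases hs
          simpa using FoldCost.join z z' hu (ih₂ (⟨j, z * z'⟩ :: a) q u i x y d hd rfl)
            (e := d + e) (by linarith)
      · cases a with
        | nil =>
          cases hs
          simpa using key x y hd rfl
        | cons t a =>
          cases hs
          simpa using FoldCost.join z z' (ih₁ p a u i x y d hd rfl) hv (e := d + e) (by linarith)

variable [∀ i, IsIsometricSMul (G i) (G i)] [∀ i, IsIsometricSMul (G i)ᵐᵒᵖ (G i)]

/-- A letter may be replaced, at the cost of the distance. -/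
theorem change {w : List (Σ i, G i)} {c : ℝ} (hw : FoldCost w c) :
    ∀ (p q : List (Σ i, G i)) (i : ι) (x y : G i), w = p ++ ⟨i, x⟩ :: q →
      FoldCost (p ++ ⟨i, y⟩ :: q) (dist x y + c) := by
  induction hw with
  | nil hc => intro p q i x y h; simp at h
  | sing z hv he ih =>
    intro p q i x y h
    cases p with
    | nil =>
      cases h
      exact .sing y hv (by linarith [dist_triangle_left y 1 z])
    | cons s p =>
      cases h
      exact .sing z (ih p q i x y rfl) (by linarith)
  | @join j z z' u v c' d' e hu hv he ih₁ ih₂ =>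
    intro p q i x y h
    cases p with
    | nil =>
      cases h
      -- By invariance the merged letter moves exactly as far as the changed one, so the change
      -- passes down to the singleton where the block ends; only there the triangle inequality is
      -- used.
      have := ih₂ [] v _ (z * z') (y * z') rfl
      rw [dist_mul_right] at this
      exact .join y z' hu this (by linarith)
    | cons s p =>
      obtain ⟨rfl, h'⟩ := List.cons_eq_cons.1 h
      rcases List.append_eq_append_iff.1 h' with ⟨a, rfl, hs⟩ | ⟨a, rfl, hs⟩
      · cases a with
        | nil =>
          cases hs
          have := ih₂ [] v _ (z * z') (z * y) rfl
          rw [dist_mul_left] at this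
          simpa using FoldCost.join z y hu this (e := dist z' y + e) (by linarith)
        | cons t a =>
          cases hs
          simpa using FoldCost.join z z' hu (ih₂ (⟨j, z * z'⟩ :: a) q i x y rfl)
            (e := dist x y + e) (by linarith)
      · cases a with
        | nil =>
          cases hs
          have := ih₂ [] v _ (z * z') (z * y) rfl
          rw [dist_mul_left] at this
          simpa using FoldCost.join z y hu this (e := dist z' y + e) (by linarith)
        | cons t a =>
          cases hs
          simpa using FoldCost.join z z' (ih₁ p a i x y rfl) hv (e := dist x y + e) (by linarith)

/-- The last letter of a folding list that is inserted may be multiplied to the next letter. -/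
theorem merge_last {w : List (Σ i, G i)} {c : ℝ} (hw : FoldCost w c) :
    ∀ (u p q : List (Σ i, G i)) (i : ι) (x y : G i) (d : ℝ), w = u ++ [⟨i, x⟩] →
      FoldCost (p ++ ⟨i, y⟩ :: q) d → FoldCost (p ++ (u ++ ⟨i, x * y⟩ :: q)) (c + d) := by
  induction hw with
  | nil hc => intro u p q i x y d h; simp at h
  | @sing j z v c e hv he ih =>
    intro u p q i x y d h hd
    cases u with
    | nil =>
      obtain ⟨h, rfl⟩ := List.cons_eq_cons.1 h
      cases h
      have h1 : dist y (z * y) = dist z 1 := by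
        rw [dist_comm]; simpa using dist_mul_right z 1 y
      exact (hd.change p q _ y (z * y) rfl).mono (by linarith [hv.nonneg])
    | cons s u =>
      cases h
      refine ((single z).insert (ih u p q i x y d rfl hd) p _ rfl).mono (by linarith)
  | @join j z z' u' v c' d' e hu hv he ih₁ ih₂ =>
    intro u p q i x y d h hd
    cases u with
    | nil => simp at h
    | cons s u =>
      obtain ⟨rfl, h'⟩ := List.cons_eq_cons.1 h
      rcases List.eq_nil_or_concat' v with rfl | ⟨v, t, rfl⟩
      · obtain ⟨rfl, h''⟩ := List.append_inj' h' rfl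
        cases h''
        -- The block `z`, `z'` ends the list. Its cost pays for changing `y` into `z * z' * y`,
        -- which is then split as `z` and `z' * y` around `u'`.
        have h1 : dist y (z * (z' * y)) = dist (z * z') 1 := by
          rw [dist_comm, ← mul_assoc]; simpa using dist_mul_right (z * z') 1 y
        have h2 := (hd.change p q _ y (z * (z' * y)) rfl).split p q u' _ z (z' * y) _ hu rfl
        simpa using h2.mono (d := e + d) (by linarith [hv.dist_le])
      · have h'' : (u' ++ ⟨j, z'⟩ :: v) ++ [t] = u ++ [⟨i, x⟩] := by simpa using h'
        obtain ⟨rfl, hs⟩ := List.append_inj' h'' rfl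
        cases hs
        -- Merge with the block closed, then reopen it by splitting `z * z'` around `u'`.
        have h1 := ih₂ (⟨j, z * z'⟩ :: v) p q i x y d (by simp) hd
        have h2 := h1.split p (v ++ ⟨i, x * y⟩ :: q) u' j z z' _ hu (by simp)
        simpa using h2.mono (d := e + d) (by linarith)

/-- The first letter of a folding list may be multiplied to the letter before it. -/
theorem merge_first {w : List (Σ i, G i)} {c : ℝ} (hw : FoldCost w c) :
    ∀ (u v : List (Σ i, G i)) (i : ι) (s x y : G i) (d : ℝ), w = ⟨i, s⟩ :: u →
      FoldCost (⟨i, x * y⟩ :: v) d → FoldCost (⟨i, x * s⟩ :: (u ++ ⟨i, y⟩ :: v)) (c + d) := by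
  induction hw with
  | nil hc => intro u v i s x y d h; simp at h
  | @sing j z v c e hv he ih =>
    intro u v i s x y d h hd
    cases h
    have := hd.change [] v _ (x * y) (x * z * y) rfl
    rw [mul_assoc, dist_mul_left] at this
    have h1 : dist y (z * y) = dist z 1 := by
      rw [dist_comm]; simpa using dist_mul_right z 1 y
    refine .join _ _ hv ?_ (by linarith : _ + (dist y (z * y) + d) ≤ _)
    rwa [mul_assoc]
  | @join j z z' u' v c' d' e hu hv he ih₁ ih₂ =>
    intro u v' i s x y d h hd
    cases h
    have := ih₂ _ _ _ _ _ _ d rfl hd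
    rw [← mul_assoc] at this
    simpa using FoldCost.join _ _ hu this (e := e + d) (by linarith)

end FoldCost

end FoldCost


/-! ### Shortening a folding to normal form -/

section Reduction

variable {ι A : Type*} {G : ι → Type*} [Group A] [∀ i, Group (G i)] (φ : ∀ i, A →* G i)

/-- The value in the amalgam of a list of letters of the factors. -/
def value (w : List (Σ i, G i)) : PushoutI φ := (w.map fun s => PushoutI.of s.1 s.2).prod

@[simp] theorem value_nil : value φ [] = 1 := rfl

@[simp] theorem value_cons (s : Σ i, G i) (w : List (Σ i, G i)) :
    value φ (s :: w) = PushoutI.of s.1 s.2 * value φ w := by simp [value]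

@[simp] theorem value_append (u v : List (Σ i, G i)) :
    value φ (u ++ v) = value φ u * value φ v := by simp [value]

/-- All letters of `w` are conjugated by `a`. -/
def conjList (a : A) (w : List (Σ i, G i)) : List (Σ i, G i) :=
  w.map fun s => ⟨s.1, φ s.1 a * s.2 * (φ s.1 a)⁻¹⟩

theorem value_conjList (a : A) (w : List (Σ i, G i)) :
    value φ (conjList φ a w) = PushoutI.base φ a * value φ w * (PushoutI.base φ a)⁻¹ := by
  induction w with
  | nil => simp [conjList]
  | cons s w ih =>
    have : conjList φ a (s :: w) = ⟨s.1, φ s.1 a * s.2 * (φ s.1 a)⁻¹⟩ :: conjList φ a w := rfl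
    rw [this, value_cons, ih]
    simp only [map_mul, map_inv, PushoutI.of_apply_eq_base, value_cons]
    group

/-- The tail of a list with first letter in `G i` is in normal form: no letter of it is in the
amalgamated subgroup, and consecutive letters lie in different factors. -/
def GoodTail (i : ι) (v : List (Σ i, G i)) : Prop :=
  (∀ s ∈ v, s.2 ∉ Set.range (φ s.1)) ∧ (i :: v.map Sigma.fst).IsChain (· ≠ ·)

variable [∀ i, MetricSpace (G i)] [∀ i, IsIsometricSMul (G i) (G i)]
  [∀ i, IsIsometricSMul (G i)ᵐᵒᵖ (G i)]

/-- Conjugation by `a` is an isometric automorphism of each factor, so it respects blocks and their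
costs. This lets an element of `A` travel past a folded sublist for free. -/
theorem FoldCost.conjList {w : List (Σ i, G i)} {c : ℝ} (hw : FoldCost w c) (a : A) :
    FoldCost (conjList φ a w) c := by
  induction hw with
  | nil hc => exact .nil hc
  | @sing i x v c e hv he ih =>
    refine .sing _ ih (le_of_eq_of_le ?_ he)
    have := dist_mul_right (φ i a * x) (φ i a) (φ i a)⁻¹
    rw [mul_inv_cancel] at this
    rw [this]
    simpa using dist_mul_left (φ i a) x 1
  | @join i x y u v c d e hu hv he ih₁ ih₂ =>
    have : (φ i a * (x * y) * (φ i a)⁻¹) =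
      (φ i a * x * (φ i a)⁻¹) * (φ i a * y * (φ i a)⁻¹) := by group
    have h2 : Graev.conjList φ a (⟨i, x * y⟩ :: v) =
      ⟨i, (φ i a * x * (φ i a)⁻¹) * (φ i a * y * (φ i a)⁻¹)⟩ :: Graev.conjList φ a v := by
      rw [← this]; rfl
    rw [h2] at ih₂
    simpa [Graev.conjList] using FoldCost.join _ _ ih₁ ih₂ he

/-- A first letter in the amalgamated subgroup can be moved into the rest. -/
theorem FoldCost.absorb_head {i : ι} {a : A} {v : List (Σ i, G i)} {c : ℝ}
    (h : FoldCost (⟨i, φ i a⟩ :: v) c) (hv : v ≠ [])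
    (hagree : ∀ i j a b, dist (φ i a) (φ i b) = dist (φ j a) (φ j b)) :
    ∃ w, w.length = v.length ∧ value φ w = value φ (⟨i, φ i a⟩ :: v) ∧ FoldCost w c := by
  generalize hw : (⟨i, φ i a⟩ :: v : List (Σ i, G i)) = w at h
  cases h with
  | nil => cases hw
  | @sing j z v' c' e h' he =>
    cases hw
    obtain _ | ⟨⟨j, y⟩, v⟩ := v
    · exact absurd rfl hv
    refine ⟨⟨j, φ j a * y⟩ :: v, rfl, by simp [PushoutI.of_apply_eq_base, mul_assoc], ?_⟩
    -- The singleton block of `a` paid its distance from 1; as the metrics agree on `A`, this covers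
    -- multiplying the next letter by `a` in another factor.
    have h1 : dist y (φ j a * y) = dist (φ i a) 1 := by
      have := hagree i j a 1
      simp only [map_one] at this
      rw [dist_comm, this]; simpa using dist_mul_right (φ j a) 1 y
    exact (h'.change [] v j y (φ j a * y) rfl).mono (by linarith)
  | @join j x y u v c' d' e hu hv' he =>
    cases hw
    -- Here `a` opens a block closed by `y`: it is carried past `u` by conjugation and multiplied
    -- into `y`.
    refine ⟨Graev.conjList φ a u ++ ⟨i, φ i a * y⟩ :: v, by simp [Graev.conjList], ?_, ?_⟩
    · simp [PushoutI.of_apply_eq_base, mul_assoc, value_conjList]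
    · exact ((hu.conjList φ a).append hv').mono he

/-- The reduction step, with the factor of the first letter kept. -/
theorem FoldCost.reduce_tail (hagree : ∀ i j a b, dist (φ i a) (φ i b) = dist (φ j a) (φ j b))
    {w : List (Σ i, G i)} {c : ℝ} (hw : FoldCost w c) :
    ∀ (i : ι) (z : G i) (v : List (Σ i, G i)), w = ⟨i, z⟩ :: v → GoodTail φ i v ∨
      ∃ (z' : G i) (v' : List (Σ i, G i)), v'.length < v.length ∧
        value φ (⟨i, z'⟩ :: v') = value φ (⟨i, z⟩ :: v) ∧ FoldCost (⟨i, z'⟩ :: v') c := by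
  induction hw with
  | nil => intro i z v h; cases h
  | @sing i x v c e hv he ih =>
    intro i x' w h
    cases h
    obtain _ | ⟨⟨j, y⟩, v⟩ := v
    · left; simp [GoodTail]
    have hyA : y ∈ Set.range (φ j) → ∃ (x' : G i) (v' : List (Σ i, G i)),
        v'.length < (⟨j, y⟩ :: v : List (Σ i, G i)).length ∧
        value φ (⟨i, x'⟩ :: v') = value φ (⟨i, x⟩ :: ⟨j, y⟩ :: v) ∧ FoldCost (⟨i, x'⟩ :: v') e := by
      rintro ⟨a, rfl⟩
      by_cases hv0 : v = []
      · subst hv0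
        refine ⟨x * φ i a, [], by simp, by simp [PushoutI.of_apply_eq_base], ?_⟩
        refine (FoldCost.single _).mono ?_
        have h1 := hv.dist_le
        have h2 := hagree i j a 1
        simp only [map_one] at h2
        have h3 := dist_triangle (x * φ i a) (x * 1) 1
        rw [dist_mul_left, mul_one] at h3
        linarith
      · obtain ⟨w, hw, hval, hc⟩ := hv.absorb_head φ hv0 hagree
        exact ⟨x, w, by simp [hw], by simpa using hval, .sing x hc he⟩
    rcases ih j y v rfl with hgood | ⟨y', v', hlen, hval, hc⟩
    · by_cases hij : i = j
      · subst hij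
        right
        refine ⟨x * y, v, by simp, by simp [mul_assoc], ?_⟩
        have h1 : dist y (x * y) = dist x 1 := by
          rw [dist_comm]; simpa using dist_mul_right x 1 y
        exact (hv.change [] v i y (x * y) rfl).mono (by linarith)
      by_cases hy : y ∈ Set.range (φ j)
      · exact .inr (hyA hy)
      · left
        refine ⟨?_, ?_⟩
        · intro s hs
          rcases List.mem_cons.1 hs with rfl | hs
          exacts [hy, hgood.1 s hs]
        · exact List.IsChain.cons_cons hij hgood.2
    · right
      exact ⟨x, ⟨j, y'⟩ :: v', by simpa using hlen, by simpa using hval, .sing x hc he⟩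
  | @join i x y u v c d e hu hv he ih₁ ih₂ =>
    intro i x' w h
    cases h
    rcases ih₂ i (x * y) v rfl with hgv | ⟨z', v', hlen, hval, hc⟩
    swap
    · right
      -- The new head of the merged list is still in `G i`, so the block can be reopened as `x` and
      -- `x⁻¹ * z'`. This is why the reduction has to keep the factor of the head.
      refine ⟨x, u ++ ⟨i, x⁻¹ * z'⟩ :: v', by simpa using hlen, ?_, .join _ _ hu ?_ he⟩
      · simp only [value_cons, map_mul] at hval
        simp [mul_assoc, hval]
      · rwa [mul_inv_cancel_left]
    by_cases hy : y ∈ Set.range (φ i)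
    · obtain ⟨a, rfl⟩ := hy
      right
      -- The closing letter is in `A` and is carried back past `u` into `x`.
      refine ⟨x * φ i a, Graev.conjList φ a⁻¹ u ++ v, by simp [Graev.conjList], ?_, ?_⟩
      · simp [PushoutI.of_apply_eq_base, value_conjList, mul_assoc]
      · exact ((hu.conjList φ a⁻¹).insert hv [⟨i, x * φ i a⟩] v rfl).mono he
    rcases List.eq_nil_or_concat' u with rfl | ⟨u₀, ⟨j, s⟩, rfl⟩
    · right
      refine ⟨x * y, v, by simp, by simp [mul_assoc], hv.mono (by linarith [hu.nonneg])⟩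
    by_cases hij : i = j
    · subst hij
      right
      refine ⟨x, u₀ ++ ⟨i, s * y⟩ :: v, by simp, by simp [mul_assoc], ?_⟩
      -- Take `u` out, leaving `x`, `y` adjacent in one block; then put it back with its last letter
      -- multiplied into `y`.
      have h1 := hv.split [] v [] i x y 0 (.nil le_rfl) rfl
      exact (hu.merge_last u₀ [⟨i, x⟩] v i s y _ rfl h1).mono (by linarith)
    generalize hu' : u₀ ++ [(⟨j, s⟩ : Σ i, G i)] = u at *
    obtain _ | ⟨⟨k, t⟩, u₁⟩ := u
    · simp at hu'
    by_cases hik : i = k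
    · subst hik
      right
      refine ⟨x * t, u₁ ++ ⟨i, y⟩ :: v, by simp, by simp [mul_assoc], ?_⟩
      exact (hu.merge_first u₁ v i t x y d rfl hv).mono he
    rcases ih₁ k t u₁ rfl with hgu | ⟨t', u', hlen, hval, hc⟩
    swap
    · right
      refine ⟨x, ⟨k, t'⟩ :: u' ++ ⟨i, y⟩ :: v, by simpa using hlen, ?_, .join _ _ hc hv he⟩
      simp only [value_cons] at hval
      simp only [value_cons, value_append, hval]
    by_cases ht : t ∈ Set.range (φ k)
    · obtain ⟨a, rfl⟩ := ht
      right
      by_cases hu0 : u₁ = []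
      · subst hu0
        have h1 := hu.dist_le
        have h2 := hagree i k a 1
        simp only [map_one] at h2
        refine ⟨x * φ i a, ⟨i, y⟩ :: v, by simp,
          by simp [PushoutI.of_apply_eq_base, mul_assoc], ?_⟩
        -- Here `u` is one letter from `A`, and its cost pays for changing `x` to `x * φ i a`.
        have h3 := hv.split [] v [] i x y 0 (.nil le_rfl) rfl
        have h4 : dist x (x * φ i a) = dist (φ i a) 1 := by
          rw [dist_comm]; simpa using dist_mul_left x (φ i a) 1
        exact (h3.change [] _ i x (x * φ i a) rfl).mono (by linarith)
      · obtain ⟨w, hw, hval, hc⟩ := hu.absorb_head φ hu0 hagree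
        refine ⟨x, w ++ ⟨i, y⟩ :: v, by simp [hw], ?_, .join _ _ hc hv he⟩
        rw [value_cons, value_append, hval, value_cons _ ⟨i, x⟩, value_append]
    left
    refine ⟨?_, ?_⟩
    · intro r hr
      simp only [List.cons_append, List.mem_cons, List.mem_append] at hr
      rcases hr with rfl | hr | rfl | hr
      exacts [ht, hgu.1 r hr, hy, hgv.1 r hr]
    · have h1 : (((⟨k, t⟩ :: u₁ : List (Σ i, G i)).map Sigma.fst) ++
          (i :: v.map Sigma.fst)).IsChain (· ≠ ·) := by
        refine List.isChain_append.2 ⟨hgu.2, hgv.2, ?_⟩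
        rw [← hu']
        simpa using Ne.symm hij
      simpa using List.IsChain.cons_cons hik (by simpa using h1)

/-- A list of letters is in normal form. -/
def IsNormal (w : List (Σ i, G i)) : Prop :=
  w.length ≤ 1 ∨ ((∀ s ∈ w, s.2 ∉ Set.range (φ s.1)) ∧ (w.map Sigma.fst).IsChain (· ≠ ·))

/-- `FoldCost.reduce_tail` says nothing about whether the head is in `A`; if it is and other letters
follow, absorbing it also shortens the list. Hence induction on the length. -/
theorem FoldCost.exists_isNormal
    (hagree : ∀ i j a b, dist (φ i a) (φ i b) = dist (φ j a) (φ j b)) (n : ℕ) :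
    ∀ {w : List (Σ i, G i)} {c : ℝ}, w.length ≤ n → FoldCost w c →
      ∃ w', IsNormal φ w' ∧ value φ w' = value φ w ∧ FoldCost w' c := by
  induction n with
  | zero => exact fun {w c} hn hw => ⟨w, .inl (hn.trans zero_le_one), rfl, hw⟩
  | succ n ih =>
    intro w c hn hw
    obtain _ | ⟨⟨i, z⟩, v⟩ := w
    · exact ⟨[], .inl zero_le_one, rfl, hw⟩
    rcases hw.reduce_tail φ hagree i z v rfl with hg | ⟨z', v', hlen, hval, hc⟩
    swap
    · obtain ⟨w', h1, h2, h3⟩ := ih (w := ⟨i, z'⟩ :: v') (by simp at hn ⊢; omega) hc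
      exact ⟨w', h1, h2.trans hval, h3⟩
    by_cases hv : v = []
    · exact ⟨_, .inl (by simp [hv]), rfl, hw⟩
    by_cases hz : z ∈ Set.range (φ i)
    · obtain ⟨a, rfl⟩ := hz
      obtain ⟨w, hw', hval, hc⟩ := hw.absorb_head φ hv hagree
      obtain ⟨w', h1, h2, h3⟩ := ih (by simp at hn; omega) hc
      exact ⟨w', h1, h2.trans hval, h3⟩
    · refine ⟨_, .inr ⟨?_, by simpa using hg.2⟩, rfl, hw⟩
      intro s hs
      rcases List.mem_cons.1 hs with rfl | hs
      exacts [hz, hg.1 s hs]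

end Reduction


/-! ### From pairs of words to foldings -/

section FoldBound

variable {ι A : Type*} {G : ι → Type*} [Group A] [∀ i, Group (G i)] [∀ i, MetricSpace (G i)]
  (φ : ∀ i, A →* G i)

/-- Some list of letters with value `f` folds up at cost at most `c`. -/
def FoldBound (f : PushoutI φ) (c : ℝ) : Prop :=
  ∃ w : List (Σ i, G i), value φ w = f ∧ FoldCost w c

variable {φ}

theorem FoldBound.mono {f : PushoutI φ} {c d : ℝ} (h : FoldBound φ f c) (hcd : c ≤ d) :
    FoldBound φ f d := by
  obtain ⟨w, hw, hc⟩ := h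
  exact ⟨w, hw, hc.mono hcd⟩

theorem FoldBound.mul {f g : PushoutI φ} {c d : ℝ} (hf : FoldBound φ f c)
    (hg : FoldBound φ g d) : FoldBound φ (f * g) (c + d) := by
  obtain ⟨u, rfl, hu⟩ := hf
  obtain ⟨v, rfl, hv⟩ := hg
  exact ⟨u ++ v, value_append φ u v, hu.append hv⟩

theorem foldBound_of {i : ι} (x : G i) :
    FoldBound φ (PushoutI.of i x) (dist x 1) :=
  ⟨[⟨i, x⟩], by simp, .single x⟩

/-- The letters `x` and `x⁻¹` form one block of product 1 around the folded list. -/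
theorem FoldBound.conj_of {f : PushoutI φ} {c : ℝ} (h : FoldBound φ f c) {i : ι} (x : G i) :
    FoldBound φ (PushoutI.of i x * f * (PushoutI.of i x)⁻¹) c := by
  obtain ⟨w, rfl, hw⟩ := h
  refine ⟨⟨i, x⟩ :: (w ++ [⟨i, x⁻¹⟩]), by simp [mul_assoc], ?_⟩
  refine .join x x⁻¹ hw (?_ : FoldCost _ 0) (by simp)
  simpa using FoldCost.single (x * x⁻¹)

variable [∀ i, IsIsometricSMul (G i)ᵐᵒᵖ (G i)]

/-- In a common factor `x * y⁻¹` is one letter. Otherwise it is the product of `x * a⁻¹` and `a *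
y⁻¹` with `a` from `A`; the infimum over `a` need not be attained, whence `ε`. -/
theorem foldBound_letterDist (hφ : ∀ i, Function.Injective (φ i))
    (hagree : ∀ i j a b, dist (φ i a) (φ i b) = dist (φ j a) (φ j b)) {x y : PushoutI φ}
    (hx : x ∈ letters φ) (hy : y ∈ letters φ) {ε : ℝ} (hε : 0 < ε) :
    FoldBound φ (x * y⁻¹) (letterDist φ x y + ε) := by
  have key : ∀ (i : ι) (g h : G i), FoldBound φ (PushoutI.of i g * (PushoutI.of i h)⁻¹)
      (dist g h) := by
    intro i g h
    have h1 : dist (g * h⁻¹) 1 = dist g h := by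
      simpa using dist_mul_right g h h⁻¹
    have := foldBound_of (φ := φ) (g * h⁻¹)
    rwa [h1, map_mul, map_inv] at this
  by_cases hm : Multipliable φ x y
  · obtain ⟨i, ⟨g, rfl⟩, ⟨h, rfl⟩⟩ := hm
    rw [letterDist_of φ hφ hagree]
    exact (key i g h).mono (by linarith)
  · rw [letterDist, if_neg hm]
    obtain ⟨i, ⟨g, rfl⟩⟩ := hx
    obtain ⟨j, ⟨h, rfl⟩⟩ := hy
    obtain ⟨r, ⟨i', j', g', h', a, hg, hh, rfl⟩, hr⟩ := Real.lt_sInf_add_pos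
      (s := {r | ∃ i' j', ∃ (g' : G i') (h' : G j') (a : A),
        PushoutI.of (φ := φ) i' g' = PushoutI.of i g ∧
        PushoutI.of (φ := φ) j' h' = PushoutI.of j h ∧
        r = dist g' (φ i' a) + dist (φ j' a) h'}) ⟨_, i, j, g, h, 1, rfl, rfl, rfl⟩ hε
    have := (key i' g' (φ i' a)).mul (key j' (φ j' a) h')
    rw [PushoutI.of_apply_eq_base, PushoutI.of_apply_eq_base] at this
    convert this.mono hr.le using 1
    simp [← hg, ← hh, mul_assoc]

theorem eval_succ {P : Type*} [Group P] {n : ℕ} (α : Fin (n + 1) → P) :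
    eval α = α 0 * eval (fun k => α k.succ) := by
  simp [eval, List.ofFn_succ]

/-- Telescoping: peeling off the first letters leaves `α 0 * (β 0)⁻¹` times a conjugate by `β 0` of
the same expression for the tails, and the conjugation is free. -/
theorem foldBound_rho (hφ : ∀ i, Function.Injective (φ i))
    (hagree : ∀ i j a b, dist (φ i a) (φ i b) = dist (φ j a) (φ j b)) {ε : ℝ} (hε : 0 < ε)
    {n : ℕ} (α β : Fin n → PushoutI φ) (hα : ∀ k, α k ∈ letters φ) (hβ : ∀ k, β k ∈ letters φ) :
    FoldBound φ (eval α * (eval β)⁻¹) (rho φ α β + n * ε) := by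
  induction n with
  | zero => exact ⟨[], by simp [eval], .nil (by simp [rho])⟩
  | succ n ih =>
    have h1 := ih (fun k => α k.succ) (fun k => β k.succ) (fun k => hα _) (fun k => hβ _)
    have h0 := foldBound_letterDist hφ hagree (hα 0) (hβ 0) hε
    obtain ⟨j, y, hy⟩ := hβ 0
    have h2 := h1.conj_of y
    rw [hy] at h2
    have h3 := h0.mul h2
    rw [eval_succ α, eval_succ β]
    have h4 : rho φ α β = letterDist φ (α 0) (β 0) +
        rho φ (fun k => α k.succ) (fun k => β k.succ) := Fin.sum_univ_succ _
    have h5 := h3.mono (d := rho φ α β + (n + 1 : ℕ) * ε) (by push_cast; linarith)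
    convert h5 using 1
    group

end FoldBound


/-! ### Values of subwords -/

section EvalOn

variable {P : Type*} [Group P] {n : ℕ}

theorem evalOn_toFinset (α : Fin n → P) {l : List (Fin n)} (hl : l.Pairwise (· < ·)) :
    evalOn α l.toFinset = (l.map α).prod := by
  have h1 : l.Nodup := hl.imp fun h => h.ne
  rw [evalOn, (List.toFinset_sort (· ≤ ·) h1).2 (hl.imp fun h => h.le)]

theorem evalOn_filter (α : Fin n → P) (p : Fin n → Prop) [DecidablePred p] :
    evalOn α (Finset.univ.filter p) = (((List.finRange n).filter p).map α).prod := by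
  rw [← evalOn_toFinset α ((List.pairwise_lt_finRange n).filter _)]
  congr 1
  ext k
  simp

theorem evalOn_empty (α : Fin n → P) : evalOn α ∅ = 1 := by simp [evalOn]

theorem evalOn_singleton (α : Fin n → P) (k : Fin n) : evalOn α {k} = α k := by simp [evalOn]

theorem evalOn_univ (α : Fin n → P) : evalOn α Finset.univ = eval α := by
  rw [evalOn, Fin.sort_univ, eval, List.ofFn_eq_map]

theorem evalOn_union (α : Fin n → P) {F F' : Finset (Fin n)} (h : ∀ k ∈ F, ∀ l ∈ F', k < l) :
    evalOn α (F ∪ F') = evalOn α F * evalOn α F' := by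
  have hs : ∀ F : Finset (Fin n), F.sort.Pairwise (· < ·) := fun F => F.sortedLT_sort.pairwise
  have := evalOn_toFinset α (l := F.sort ++ F'.sort) (List.pairwise_append.2
    ⟨hs F, hs F', fun k hk l hl => h k (by simpa using hk) l (by simpa using hl)⟩)
  rw [List.toFinset_append, Finset.sort_toFinset, Finset.sort_toFinset] at this
  simpa [evalOn] using this

theorem evalOn_congr {α β : Fin n → P} {F : Finset (Fin n)} (h : ∀ k ∈ F, α k = β k) :
    evalOn α F = evalOn β F := by
  rw [evalOn, evalOn]
  congr 1
  exact List.map_congr_left fun k hk => h k (by simpa using hk)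

end EvalOn

/-! ### Reading a symmetrized word and labelled blocks off a folding -/

section Labelled

variable {ι : Type*} {G : ι → Type*} [∀ i, Group (G i)]

/-- A letter `x` of a factor, with a letter `z` of the same factor and the label of a block. -/
structure Entry (G : ι → Type*) where
  idx : ι
  x : G idx
  z : G idx
  lab : ℕ

/-- The labelled lists that arise from a folding up: the labels mark the blocks, and in each block
the letters `z` are those of the symmetrization at the first position. -/
inductive Labelled : List (Entry G) → Prop
  | nil : Labelled []
  | sing {i : ι} (x : G i) (b : ℕ) {l : List (Entry G)} (hl : Labelled l)
      (hb : ∀ e ∈ l, e.lab ≠ b) : Labelled (⟨i, x, 1, b⟩ :: l)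
  | join {i : ι} (x y z : G i) (b : ℕ) {k l : List (Entry G)} (hk : Labelled k)
      (hl : Labelled (⟨i, x * y, z, b⟩ :: l)) (hb : ∀ e ∈ k, e.lab ≠ b)
      (hd : ∀ e ∈ k, ∀ e' ∈ l, e.lab ≠ e'.lab) :
      Labelled (⟨i, x, z * y⁻¹, b⟩ :: (k ++ ⟨i, y, y, b⟩ :: l))

/-- Only the first letter of a block differs from its partner, and its distance is that of the block
product from 1. The lower bound `N` on the labels serves to keep the labels of different sublists
apart. -/
theorem FoldCost.exists_labelled [∀ i, MetricSpace (G i)] [∀ i, IsIsometricSMul (G i)ᵐᵒᵖ (G i)]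
    {w : List (Σ i, G i)} {c : ℝ} (h : FoldCost w c) : ∀ N : ℕ, ∃ l : List (Entry G), Labelled l ∧
      l.map (fun e => (⟨e.idx, e.x⟩ : Σ i, G i)) = w ∧ (∀ e ∈ l, N ≤ e.lab) ∧
      (l.map fun e => dist e.x e.z).sum ≤ c := by
  induction h with
  | nil hc => exact fun N => ⟨[], .nil, rfl, by simp, by simpa using hc⟩
  | sing x hv he ih =>
    intro N
    obtain ⟨l, h1, rfl, h3, h4⟩ := ih (N + 1)
    refine ⟨⟨_, x, 1, N⟩ :: l, .sing x N h1 fun e he => ?_, rfl, ?_, ?_⟩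
    · have := h3 e he
      omega
    · intro e he
      rcases List.mem_cons.1 he with rfl | he
      exacts [le_rfl, (Nat.le_succ N).trans (h3 e he)]
    · simp only [List.map_cons, List.sum_cons]
      linarith
  | @join i x y u v c d e hu hv he ih₁ ih₂ =>
    intro N
    obtain ⟨l, h1, h2, h3, h4⟩ := ih₂ N
    obtain _ | ⟨⟨j, x', z, b⟩, l⟩ := l
    · simp at h2
    simp only [List.map_cons] at h2
    obtain ⟨h2, rfl⟩ := List.cons_eq_cons.1 h2
    cases h2
    -- `M` exceeds every label of the merged list, so the inner list gets fresh ones.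
    obtain ⟨M, hM⟩ := ((b :: l.map Entry.lab).toFinset).exists_nat_subset_range
    obtain ⟨k, k1, rfl, k3, k4⟩ := ih₁ (M + N)
    have hbM : b < M := by simpa using hM (List.mem_toFinset.2 List.mem_cons_self)
    have hlM : ∀ e ∈ l, e.lab < M := fun e he => by
      simpa using hM (List.mem_toFinset.2 (List.mem_cons_of_mem _ (List.mem_map_of_mem he)))
    have hbN : N ≤ b := h3 _ List.mem_cons_self
    refine ⟨_, .join x y z b k1 h1 ?_ ?_, by simp, ?_, ?_⟩
    · intro e he
      have := k3 e he
      omega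
    · intro e he e' he'
      have := k3 e he
      have := hlM e' he'
      omega
    · intro e he
      simp only [List.mem_cons, List.mem_append] at he
      rcases he with rfl | he | rfl | he
      · exact hbN
      · have := k3 e he
        omega
      · exact hbN
      · exact h3 e (List.mem_cons_of_mem _ he)
    · simp only [List.map_cons, List.sum_cons, List.map_append, List.sum_append, dist_self] at h4 ⊢
      have : dist x (z * y⁻¹) = dist (x * y) z := by
        simpa using (dist_mul_right x (z * y⁻¹) y).symm
      linarith

theorem Labelled.pairwise {l : List (Entry G)} (h : Labelled l) :
    l.Pairwise fun e e' => e.lab = e'.lab → e.idx = e'.idx ∧ e'.z = e'.x := by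
  induction h with
  | nil => exact .nil
  | sing x b hl hb ih => exact .cons (fun e he h => absurd h.symm (hb e he)) ih
  | join x y z b hk hl hb hd ih₁ ih₂ =>
    obtain ⟨h1, h2⟩ := List.pairwise_cons.1 ih₂
    refine .cons ?_ (List.pairwise_append.2 ⟨ih₁, .cons h1 h2, ?_⟩)
    · intro e he hlab
      simp only [List.mem_append, List.mem_cons] at he
      rcases he with he | rfl | he
      · exact absurd hlab.symm (hb e he)
      · exact ⟨rfl, rfl⟩
      · exact h1 e he hlab
    · intro e he e' he' hlab
      rcases List.mem_cons.1 he' with rfl | he'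
      · exact absurd hlab (hb e he)
      · exact absurd hlab (hd e he e' he')

theorem Labelled.prod_filter {A : Type*} [Group A] (φ : ∀ i, A →* G i) {l : List (Entry G)}
    (h : Labelled l) (b : ℕ) :
    ((l.filter fun e => e.lab = b).map fun e => PushoutI.of (φ := φ) e.idx e.z).prod = 1 := by
  induction h with
  | nil => rfl
  | sing x b' hl hb ih =>
    rw [List.filter_cons]
    split_ifs <;> simpa using ih
  | @join i x y z b' k l hk hl hb hd ih₁ ih₂ =>
    by_cases h : b' = b
    · subst h
      simp only [List.filter_cons, List.filter_append, decide_true, if_true, List.map_cons,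
        List.map_append, List.prod_cons, List.prod_append, ih₁] at ih₂ ⊢
      simpa [mul_assoc] using ih₂
    · simp only [List.filter_cons, List.filter_append, h, decide_false, List.map_append,
        List.prod_append, ih₁, Bool.false_eq_true, if_false] at ih₂ ⊢
      simpa using ih₂

/-- The inner list `k` is a contiguous run whose labels occur nowhere else, so a crossing would lie
entirely inside it or entirely in the merged list. -/
theorem Labelled.noncrossing {l : List (Entry G)} (h : Labelled l) :
    ∀ a b : ℕ, a ≠ b → ¬ [a, b, a, b].Sublist (l.map Entry.lab) := by
  induction h with
  | nil => simp
  | sing x b' hl hb ih =>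
    intro a b hab h
    rw [List.map_cons] at h
    rcases List.sublist_cons_iff.1 h with h | ⟨r, hr, h⟩
    · exact ih a b hab h
    · cases hr
      have := h.subset (show b' ∈ [b, b', b] by simp)
      obtain ⟨e, he, hea⟩ := List.mem_map.1 this
      exact hb e he hea
  | @join i x y z c k l hk hl hb hd ih₁ ih₂ =>
    intro a b hab h
    simp only [List.map_cons, List.map_append] at h ih₂
    generalize hK : k.map Entry.lab = K at *
    generalize hM : l.map Entry.lab = M at *
    have hcK : c ∉ K := by
      rw [← hK]; intro hc
      obtain ⟨e, he, hec⟩ := List.mem_map.1 hc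
      exact hb e he hec
    have hKM : ∀ m ∈ K, m ∉ M := by
      rw [← hK, ← hM]; intro m hm hm'
      obtain ⟨e, he, rfl⟩ := List.mem_map.1 hm
      obtain ⟨e', he', hee⟩ := List.mem_map.1 hm'
      exact hd e he e' he' hee.symm
    have hKc : ∀ m ∈ K, m ∉ c :: M := by
      intro m hm hm'
      rcases List.mem_cons.1 hm' with rfl | hm'
      exacts [hcK hm, hKM m hm hm']
    have hpat : ∀ a b, a ∈ K → b ∉ K → ¬ [a, b, a].Sublist (c :: (K ++ c :: M)) := by
      intro a b ha hb h
      rcases List.sublist_cons_iff.1 h with h | ⟨r, hr, h⟩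
      · obtain ⟨l₁, l₂, hl, h₁, h₂⟩ := List.sublist_append_iff.1 h
        rcases List.eq_nil_or_concat' l₂ with rfl | ⟨l₂, t, rfl⟩
        · rw [List.append_nil] at hl
          subst hl
          exact hb (h₁.subset (by simp))
        · have : ([a, b] ++ [a] : List ℕ) = (l₁ ++ l₂) ++ [t] := by simpa using hl
          obtain ⟨-, h⟩ := List.append_inj' this rfl
          cases h
          exact hKc a ha (h₂.subset (by simp))
      · cases hr
        exact hcK ha
    have hsub : ∀ p : List ℕ, p.Sublist [a, b, a, b] → p.Sublist (c :: (K ++ c :: M)) :=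
      fun p hp => hp.trans h
    by_cases ha : a ∈ K <;> by_cases hb : b ∈ K
    · have := h.filter (fun m => m ∈ K)
      have h1 : M.filter (fun m => m ∈ K) = [] := by
        rw [List.filter_eq_nil_iff]
        intro m hm hm'
        exact hKM m (by simpa using hm') hm
      simp only [List.filter_cons, List.filter_append, h1, ha, hb, hcK, decide_true, decide_false, if_true,
        Bool.false_eq_true, if_false, List.append_nil, List.filter_nil] at this
      exact ih₁ a b hab (this.trans List.filter_sublist)
    · exact hpat a b ha hb (hsub _ (by simp))
    · exact hpat b a hb ha (hsub _ (by simp))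
    · have := h.filter (fun m => m ∉ K)
      have h1 : K.filter (fun m => m ∉ K) = [] := by simp
      simp only [List.filter_cons, List.filter_append, h1, ha, hb, hcK, decide_true, if_true,
        not_false_eq_true, List.nil_append, List.filter_nil] at this
      -- A doubled `c` cannot help an alternating pattern, so it already embeds in `c :: M`.
      have h2 : [a, b, a, b].Sublist (c :: c :: M) :=
        this.trans ((List.filter_sublist.cons_cons c).cons_cons c)
      rcases List.sublist_cons_iff.1 h2 with h | ⟨r, hr, h⟩
      · exact ih₂ a b hab h
      · cases hr
        rcases List.sublist_cons_iff.1 h with h | ⟨r, hr, h⟩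
        · exact ih₂ c b hab (h.cons_cons c)
        · cases hr
          exact hab rfl

end Labelled


/-! ### Rooted trees from ancestor relations -/

section TreeOfAncestors

/-- A finite linear order with a compatible relation "`t` is an ancestor of `s`" is a rooted
tree. -/
theorem exists_parent {N : Type*} [LinearOrder N] [Finite N] (root : N) (anc : N → N → Prop)
    (hlt : ∀ s t, anc s t → t < s) (htrans : ∀ s t u, anc s t → anc t u → anc s u)
    (hchain : ∀ s t u, anc s t → anc s u → t < u → anc u t)
    (hroot : ∀ s, s ≠ root → anc s root) (hmin : ∀ s, root ≤ s) :
    ∃ par : N → N, par root = root ∧ (∀ t, ∃ k : ℕ, par^[k] t = root) ∧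
      ∀ s t, (s ≠ t ∧ ∃ k : ℕ, par^[k] s = t) ↔ anc s t := by
  -- The parent is the nearest ancestor, which is the largest one in the order.
  have h : ∀ s, ∃ p, (s = root → p = root) ∧ (s ≠ root → anc s p ∧ ∀ t, anc s t → t ≤ p) := by
    intro s
    by_cases hs : s = root
    · exact ⟨root, fun _ => rfl, fun h => absurd hs h⟩
    · obtain ⟨p, hp, hmax⟩ := Set.exists_max_image {t | anc s t} id (Set.toFinite _)
        ⟨root, hroot s hs⟩
      exact ⟨p, fun h => absurd h hs, fun _ => ⟨hp, hmax⟩⟩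
  choose par hpar0 hpar using h
  have hback : ∀ s t, anc s t → ∃ k : ℕ, par^[k] s = t := by
    intro s
    induction s using WellFoundedLT.induction with
    | ind s ih =>
      intro t hst
      have hs : s ≠ root := fun h => absurd (hlt s t hst) (not_lt.2 (h ▸ hmin t))
      obtain ⟨h1, h2⟩ := hpar s hs
      rcases (h2 t hst).eq_or_lt with rfl | hlt'
      · exact ⟨1, rfl⟩
      · obtain ⟨k, hk⟩ := ih _ (hlt _ _ h1) t (hchain s t _ hst h1 hlt')
        exact ⟨k + 1, hk⟩
  refine ⟨par, hpar0 root rfl, fun t => ?_, fun s t => ⟨?_, fun h => ⟨(hlt s t h).ne', hback s t h⟩⟩⟩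
  · by_cases ht : t = root
    · exact ⟨0, ht⟩
    · exact hback t root (hroot t ht)
  · rintro ⟨hne, k, rfl⟩
    have : ∀ k : ℕ, par^[k] s = s ∨ anc s (par^[k] s) := by
      intro k
      induction k with
      | zero => exact .inl rfl
      | succ k ih =>
        rw [Function.iterate_succ_apply']
        by_cases hr : par^[k] s = root
        · rw [hr, hpar0 root rfl, ← hr]
          exact ih
        · right
          rcases ih with h | h
          · rw [h] at hr ⊢
            exact (hpar s hr).1
          · exact htrans _ _ _ h (hpar _ hr).1
    exact (this k).resolve_left hne.symm

theorem Tree.iterate_height (T : Tree) (t : T.Node) : T.parent^[T.height t] t = T.root :=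
  Nat.sInf_mem (T.reaches_root t)

theorem Tree.height_le (T : Tree) {t : T.Node} {k : ℕ} (h : T.parent^[k] t = T.root) :
    T.height t ≤ k := Nat.sInf_le h

theorem Tree.iterate_root (T : Tree) (k : ℕ) : T.parent^[k] T.root = T.root :=
  Function.iterate_fixed T.parent_root k

theorem Tree.Below.height_lt {T : Tree} {s t : T.Node} (h : T.Below s t) :
    T.height t < T.height s := by
  obtain ⟨hne, k, rfl⟩ := h
  have hk : k ≠ 0 := by
    rintro rfl
    exact hne rfl
  have hs := T.iterate_height s
  rcases le_or_gt (T.height s) k with hle | hgt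
  · obtain ⟨j, rfl⟩ := Nat.exists_eq_add_of_le' hle
    rw [Function.iterate_add_apply, hs, T.iterate_root] at hne ⊢
    have h0 : T.height T.root ≤ 0 := T.height_le rfl
    refine lt_of_le_of_lt h0 (Nat.pos_of_ne_zero fun h => hne ?_)
    rwa [h] at hs
  · obtain ⟨j, hj⟩ := Nat.exists_eq_add_of_le' hgt.le
    have : T.height (T.parent^[k] s) ≤ j :=
      T.height_le (by rw [← Function.iterate_add_apply, ← hj, hs])
    omega

end TreeOfAncestors

/-! ### The slim tree of a noncrossing partition -/

section Noncrossing

variable {m : ℕ}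

/-- The labels mark the blocks of a noncrossing partition. -/
def Noncrossing (L : Fin (m + 1) → ℕ) : Prop :=
  ∀ a b c d, a < b → b < c → c < d → L a = L c → L b = L d → L a = L b

/-- A set of positions that is a union of blocks of value `1` has value `1`. -/
theorem Noncrossing.evalOn_eq_one {P : Type*} [Group P] {L : Fin (m + 1) → ℕ} (hL : Noncrossing L)
    {ζ : Fin (m + 1) → P} (hprod : ∀ b, evalOn ζ (Finset.univ.filter (L · = b)) = 1)
    (J : Finset (Fin (m + 1))) (hJ : ∀ x y, L x = L y → x ∈ J → y ∈ J) : evalOn ζ J = 1 := by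
  induction J using Finset.strongInduction with
  | H J ih =>
    rcases J.eq_empty_or_nonempty with rfl | hne
    · exact evalOn_empty ζ
    have hfirst : ∀ x ∈ J, ∃ y ∈ J, L y = L x ∧ ∀ l, L l = L y → y ≤ l := by
      intro x hx
      have hne : (Finset.univ.filter (L · = L x)).Nonempty := ⟨x, by simp⟩
      have h1 := Finset.min'_mem _ hne
      simp only [Finset.mem_filter, Finset.mem_univ, true_and] at h1
      exact ⟨_, hJ x _ h1.symm hx, h1, fun l hl =>
        Finset.min'_le _ _ (by simp only [Finset.mem_filter, Finset.mem_univ, true_and]; exact hl.trans h1)⟩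
    -- Choose the block in `J` that begins last. No other position of `J` lies within its span: the
    -- block of such a position would begin before `k` and cross it. So this block contributes a
    -- contiguous factor 1 and can be removed.
    obtain ⟨k, hk, hkmax⟩ := Set.exists_max_image {k | k ∈ J ∧ ∀ l, L l = L k → k ≤ l} id
      (Set.toFinite _) (by
        obtain ⟨x, hx⟩ := hne
        obtain ⟨y, hy, -, hy'⟩ := hfirst x hx
        exact ⟨y, hy, hy'⟩)
    have hsep : ∀ x ∈ J, L x ≠ L k → k < x → ∀ l, L l = L k → l < x := by
      intro x hx hxk hlt l hl
      by_contra hle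
      obtain ⟨y, hy, hyx, hy'⟩ := hfirst x hx
      have hyk : y ≤ k := hkmax y ⟨hy, hy'⟩
      have hxl : x < l := lt_of_le_of_ne (not_lt.1 hle) fun h => hxk (h ▸ hl)
      have hyk' : y < k := lt_of_le_of_ne hyk fun h => hxk (by rw [← hyx, h])
      exact hxk (hyx.symm.trans (hL y k x l hyk' hlt hxl hyx hl.symm))
    set J₁ := J.filter (· < k)
    set J₂ := J.filter fun x => k < x ∧ L x ≠ L k
    have hJ12 : J₁ ∪ J₂ ⊂ J := by
      refine ⟨Finset.union_subset (Finset.filter_subset _ _) (Finset.filter_subset _ _), fun h => ?_⟩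
      have := h hk.1
      simp [J₁, J₂] at this
    have hdec : J = J₁ ∪ (Finset.univ.filter (L · = L k) ∪ J₂) := by
      ext x
      simp only [J₁, J₂, Finset.mem_union, Finset.mem_filter, Finset.mem_univ, true_and]
      constructor
      · intro hx
        by_cases h : L x = L k
        · exact .inr (.inl h)
        rcases lt_trichotomy x k with h' | rfl | h'
        · exact .inl ⟨hx, h'⟩
        · exact absurd rfl h
        · exact .inr (.inr ⟨hx, h', h⟩)
      · rintro (h | h | h)
        exacts [h.1, hJ k x h.symm hk.1, h.1]
    rw [hdec, evalOn_union, evalOn_union, hprod, one_mul, ← evalOn_union]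
    · refine ih _ hJ12 fun x y hxy hx => ?_
      have hxJ := hJ12.1 hx
      have hxk : L x ≠ L k := by
        simp only [J₁, J₂, Finset.mem_union, Finset.mem_filter] at hx
        rcases hx with hx | hx
        · exact fun h => absurd hx.2 (not_lt.2 (hk.2 x h))
        · exact hx.2.2
      have hyJ := hJ x y hxy hxJ
      simp only [J₁, J₂, Finset.mem_union, Finset.mem_filter]
      rcases lt_trichotomy y k with h' | rfl | h'
      · exact .inl ⟨hyJ, h'⟩
      · exact absurd hxy hxk
      · exact .inr ⟨hyJ, h', hxy ▸ hxk⟩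
    · intro x hx y hy
      exact (Finset.mem_filter.1 hx).2.trans (Finset.mem_filter.1 hy).2.1
    · intro x hx y hy
      obtain ⟨hy, hky, hyL⟩ := Finset.mem_filter.1 hy
      exact hsep y hy hyL hky x (Finset.mem_filter.1 hx).2
    · intro x hx y hy
      have hxk := (Finset.mem_filter.1 hx).2
      rcases Finset.mem_union.1 hy with hy | hy
      · exact hxk.trans_le (hk.2 y (Finset.mem_filter.1 hy).2)
      · exact hxk.trans (Finset.mem_filter.1 hy).2.1

/-- The tree of the blocks of a noncrossing partition. -/
theorem Noncrossing.exists_intervalTree {L : Fin (m + 1) → ℕ} (hL : Noncrossing L) :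
    ∃ T : IntervalTree (m + 1), T.I T.root = Finset.univ ∧
      (∀ s t, T.height t ≤ T.height s → (T.I s ∩ T.I t).Nonempty → T.Below s t ∨ s = t) ∧
      (∀ s t, T.Below s t → t ≠ T.root → T.lo t < T.lo s ∧ T.hi s < T.hi t) ∧
      ∀ t, (∀ l, l ∈ T.R t ↔ L l = L (T.lo t)) ∧ (∀ l, L l = L (T.lo t) → T.lo t ≤ l) ∧
        ∀ x y, L x = L y → x ∈ T.I t → y ∈ T.I t := by
  have hlast : ∀ k, ∃ h, L h = L k ∧ ∀ l, L l = L k → l ≤ h := by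
    intro k
    obtain ⟨h, h1, h2⟩ := Set.exists_max_image {l | L l = L k} id (Set.toFinite _) ⟨k, rfl⟩
    exact ⟨h, h1, h2⟩
  choose last hlast hle_last using hlast
  -- The nodes are the blocks, represented by their first positions.
  let N := {k : Fin (m + 1) // ∀ l, L l = L k → k ≤ l}
  let root : N := ⟨0, fun l _ => Fin.zero_le l⟩
  have hfirst : ∀ k, ∃ s : N, L s.1 = L k ∧ s.1 ≤ k := by
    intro k
    obtain ⟨h, h1, h2⟩ := Set.exists_min_image {l | L l = L k} id (Set.toFinite _) ⟨k, rfl⟩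
    exact ⟨⟨h, fun l hl => h2 l (hl.trans h1)⟩, h1, h2 k rfl⟩
  have hN : ∀ s t : N, L s.1 = L t.1 → s = t := fun s t h =>
    Subtype.ext (le_antisymm (s.2 _ h.symm) (t.2 _ h))
  -- The interval of a node is the span of its block, except that the block of position 0 is the
  -- root and must get all positions.
  let hi : N → Fin (m + 1) := fun t => if t.1 = 0 then Fin.last m else last t.1
  have hlasthi : ∀ t : N, last t.1 ≤ hi t := by
    intro t
    by_cases ht : t.1 = 0
    · simp only [hi, ht, if_true]; exact Fin.le_last _
    · simp only [hi, ht, if_false]; exact le_rfl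
  have hself : ∀ t : N, t.1 ≤ hi t := fun t => (hle_last t.1 t.1 rfl).trans (hlasthi t)
  have hcross : ∀ s t : N, t < s → s.1 ≤ last t.1 → last s.1 < last t.1 := by
    intro s t hts hst
    have hne : L t.1 ≠ L s.1 := fun h => hts.ne (hN t s h)
    have h1 : s.1 < last t.1 := lt_of_le_of_ne hst fun h => hne (by rw [h, hlast])
    by_contra hle
    have h2 : last t.1 < last s.1 := lt_of_le_of_ne (not_lt.1 hle) fun h => hne (by
      rw [← hlast t.1, h, hlast])
    exact hne (hL _ _ _ _ hts h1 h2 (hlast _).symm (hlast _).symm)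
  have hnest : ∀ s t : N, t < s → s.1 ≤ hi t → hi s ≤ hi t := by
    intro s t hts hst
    by_cases ht : t.1 = 0
    · simp only [hi, ht, if_true]; exact Fin.le_last _
    · have hs : s.1 ≠ 0 := fun h => absurd hts (not_lt.2 (show s.1 ≤ t.1 from h ▸ Fin.zero_le _))
      simp only [hi, ht, hs, if_false] at hst ⊢
      exact (hcross s t hts hst).le
  obtain ⟨par, hpar, hreach, hbelow⟩ := exists_parent root (fun s t : N => t < s ∧ s.1 ≤ hi t)
    (fun s t h => h.1) (fun s t u h h' => ⟨h'.1.trans h.1, h.2.trans (hnest t u h'.1 h'.2)⟩)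
    (fun s t u h h' htu => ⟨htu, (le_of_lt h'.1 : u.1 ≤ s.1).trans h.2⟩)
    (fun s hs => ⟨lt_of_le_of_ne (Fin.zero_le s.1) (Ne.symm hs), by simpa [hi, root] using Fin.le_last _⟩)
    (fun s => Fin.zero_le s.1)
  let T : IntervalTree (m + 1) := ⟨⟨N, root, par, hpar, hreach⟩, fun t => t.1, hi, hself⟩
  have hB : ∀ s t : N, T.Below s t ↔ t < s ∧ s.1 ≤ hi t := hbelow
  have hI : ∀ (t : N) k, k ∈ T.I t ↔ t.1 ≤ k ∧ k ≤ hi t := fun t k => Finset.mem_Icc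
  have hsat : ∀ (t : N) x y, L x = L y → x ∈ T.I t → y ∈ T.I t := by
    intro t x y hxy hx
    rw [hI] at hx ⊢
    by_cases ht : t.1 = 0
    · simp only [hi, ht, if_true]
      exact ⟨Fin.zero_le y, Fin.le_last y⟩
    · by_cases hLx : L x = L t.1
      · exact ⟨t.2 y (hxy ▸ hLx), (hle_last t.1 y (hxy ▸ hLx)).trans (hlasthi t)⟩
      · simp only [hi, ht, if_false] at hx ⊢
        have h1 : t.1 < x := lt_of_le_of_ne hx.1 fun h => hLx (h ▸ rfl)
        have h2 : x < last t.1 := lt_of_le_of_ne hx.2 fun h => hLx (by rw [h, hlast])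
        constructor
        · by_contra h
          exact hLx (hxy.trans (hL y t.1 x _ (not_le.1 h) h1 h2 hxy.symm (hlast _).symm))
        · by_contra h
          exact hLx (hL t.1 x _ y h1 h2 (not_le.1 h) (hlast _).symm hxy).symm
  refine ⟨T, ?_, ?_, ?_, ?_⟩
  · ext k
    simp only [Finset.mem_univ, iff_true]
    rw [hI]
    exact ⟨Fin.zero_le k, by simpa [T, hi, root] using Fin.le_last k⟩
  · intro s t hh ⟨x, hx⟩
    rw [Finset.mem_inter, hI, hI] at hx
    rcases lt_trichotomy (α := N) s t with h | h | h
    · have : T.Below t s := (hB t s).2 ⟨h, hx.2.1.trans hx.1.2⟩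
      exact absurd this.height_lt (not_lt.2 hh)
    · exact .inr h
    · exact .inl ((hB s t).2 ⟨h, hx.1.1.trans hx.2.2⟩)
  · intro s t hst ht
    obtain ⟨h1, h2⟩ := (hB s t).1 hst
    refine ⟨h1, ?_⟩
    have ht0 : Subtype.val (p := fun k => ∀ l, L l = L k → k ≤ l) t ≠ 0 :=
      fun h => ht (Subtype.ext h)
    have hs0 : Subtype.val (p := fun k => ∀ l, L l = L k → k ≤ l) s ≠ 0 :=
      fun h => absurd h1 (not_lt.2 (show Subtype.val (p := fun k => ∀ l, L l = L k → k ≤ l) s ≤ _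
        from h ▸ Fin.zero_le _))
    simp only [T, hi, ht0, hs0, if_false] at h2 ⊢
    exact hcross s t h1 h2
  · intro t
    -- Intervals are unions of blocks. A position of `T.I t` from another block lies in the span of
    -- that block, which is a node below `t`; a position of the block of `t` in a lower interval
    -- would drag `T.lo t` into it.
    refine ⟨fun k => ⟨?_, ?_⟩, t.2, hsat t⟩
    · rintro ⟨hk, hkR⟩
      rw [hI] at hk
      obtain ⟨s, hs, hsk⟩ := hfirst k
      by_contra hne
      have hkI : k ∈ T.I s := (hI s k).2 ⟨hsk, (hle_last s.1 k hs.symm).trans (hlasthi s)⟩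
      rcases lt_trichotomy (α := N) s t with h | h | h
      · have h1 := hsat t k s.1 hs.symm ((hI t k).2 hk)
        exact absurd ((hI t s.1).1 h1).1 (not_le.2 h)
      · exact hne (h ▸ hs.symm)
      · exact hkR s ((hB s t).2 ⟨h, hsk.trans hk.2⟩) hkI
    · intro hk
      refine ⟨hsat t _ k hk.symm ((hI t _).2 ⟨le_rfl, hself t⟩), fun s hs hks => ?_⟩
      have h1 := hsat s k (T.lo t) hk hks
      exact absurd ((hI s _).1 h1).1 (not_le.2 ((hB s t).1 hs).1)

variable {ι A : Type*} {G : ι → Type*} [Group A] [∀ i, Group (G i)] {φ : ∀ i, A →* G i}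

/-- The symmetric pair of a noncrossing partition. -/
theorem Noncrossing.isSymmetricPair {L : Fin (m + 1) → ℕ} (hL : Noncrossing L)
    {α ζ : Fin (m + 1) → PushoutI φ} (typ : Fin (m + 1) → ι)
    (hα : ∀ k, α k ∈ (PushoutI.of (φ := φ) (typ k)).range)
    (hζ : ∀ k, ζ k ∈ (PushoutI.of (φ := φ) (typ k)).range)
    (hpair : ∀ k l, k < l → L k = L l → typ k = typ l ∧ ζ l = α l)
    (hprod : ∀ b, evalOn ζ (Finset.univ.filter (L · = b)) = 1) :
    IsSymmetricPair φ (eval α) α ζ := by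
  obtain ⟨T, hroot, horder, hstrict, hT⟩ := hL.exists_intervalTree
  have htyp : ∀ k l, L k = L l → typ k = typ l := by
    intro k l h
    rcases lt_trichotomy k l with h' | rfl | h'
    exacts [(hpair k l h' h).1, rfl, (hpair l k h' h.symm).1.symm]
  have hW : ∀ {α : Fin (m + 1) → PushoutI φ},
      (∀ k, α k ∈ (PushoutI.of (φ := φ) (typ k)).range) → IsWord φ α :=
    fun h => ⟨m.succ_pos, fun k => ⟨typ k, h k⟩⟩
  have h1 : ∀ t, evalOn ζ (T.I t) = 1 := fun t => hL.evalOn_eq_one hprod _ (hT t).2.2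
  have hev : eval ζ = 1 := by rw [← evalOn_univ, ← hroot, h1]
  have hmult : ∀ {x : PushoutI φ} {y : PushoutI φ} {k l}, L k = L l →
      x ∈ (PushoutI.of (φ := φ) (typ k)).range → y ∈ (PushoutI.of (φ := φ) (typ l)).range →
      Multipliable φ x y := fun h hx hy => ⟨_, hx, htyp _ _ h ▸ hy⟩
  refine ⟨T, ⟨⟨hW hα, hW hζ, rfl, hev⟩, fun k => ⟨typ k, hα k, hζ k⟩⟩, ⟨⟨hW hζ, hev, hroot,
    fun t => h1 t ▸ one_mem _, horder, hstrict, fun t k hk l hl => ?_⟩, h1⟩, fun t => ?_⟩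
  · exact hmult (((hT t).1 k).1 hk |>.trans (((hT t).1 l).1 hl).symm) (hζ k) (hζ l)
  · obtain ⟨hR, hfirst, -⟩ := hT t
    -- The admissible list is the whole block and the distinguished position is its first one, so
    -- the left factor of the symmetrized letter is an empty product.
    refine ⟨Finset.univ.filter (L · = L (T.lo t)), ⟨fun k hk => ?_, fun k hk _ => ?_,
      fun k hk l hl => ?_⟩, T.lo t, by simp, ?_⟩
    · exact (hR k).2 (Finset.mem_filter.1 hk).2
    · simpa using (hR k).1 hk
    · simp only [Finset.mem_filter, Finset.mem_univ, true_and] at hk hl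
      exact hmult (hk.trans hl.symm) (hα k) (hα l)
    · rw [symmetrization]
      split_ifs with hcard
      · rfl
      funext k
      have hlt : ∀ l, L l = L (T.lo t) → l ≠ T.lo t → ζ l = α l := fun l hl hne =>
        (hpair _ l (lt_of_le_of_ne (hfirst l hl) hne.symm) hl.symm).2
      split_ifs with hk hkF
      · subst hk
        have h0 : (Finset.univ.filter (L · = L (T.lo t))).filter (· < T.lo t) = ∅ := by
          ext l
          simpa using fun h => hfirst l h
        have hdec : Finset.univ.filter (L · = L (T.lo t)) =
            {T.lo t} ∪ (Finset.univ.filter (L · = L (T.lo t))).filter (T.lo t < ·) := by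
          ext l
          simp only [Finset.mem_union, Finset.mem_filter, Finset.mem_univ, true_and,
            Finset.mem_singleton]
          constructor
          · intro h
            rcases (hfirst l h).eq_or_lt with h' | h'
            exacts [.inl h'.symm, .inr ⟨h, h'⟩]
          · rintro (rfl | h)
            exacts [rfl, h.1]
        have hp := hprod (L (T.lo t))
        rw [hdec, evalOn_union, evalOn_singleton] at hp
        · rw [h0, evalOn_empty, inv_one, one_mul, eq_inv_of_mul_eq_one_left hp]
          congr 1
          refine evalOn_congr fun l hl => ?_
          simp only [Finset.mem_filter, Finset.mem_univ, true_and] at hl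
          exact hlt l hl.1 hl.2.ne'
        · intro x hx y hy
          rw [Finset.mem_singleton.1 hx]
          exact (Finset.mem_filter.1 hy).2
      · exact hlt k (by simpa using hkF) hk
      · rfl

end Noncrossing


/-! ### The norm as an infimum over symmetric reduced pairs -/

section ReducedPairs

variable {ι A : Type*} {G : ι → Type*} [Group A] [∀ i, Group (G i)] (φ : ∀ i, A →* G i)

/-- Two factors meet only in `A`, so a letter outside `A` lies in just one factor. -/
theorem not_multipliable (hφ : ∀ i, Function.Injective (φ i)) {i j : ι} (hij : i ≠ j) {x : G i}
    {y : G j} (hx : x ∉ Set.range (φ i)) (hy : y ∉ Set.range (φ j)) :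
    ¬ Multipliable φ (PushoutI.of i x) (PushoutI.of j y) := by
  have key : ∀ (k l : ι) (z : G l), z ∉ Set.range (φ l) → k ≠ l →
      PushoutI.of (φ := φ) l z ∉ (PushoutI.of (φ := φ) k).range := by
    intro k l z hz hkl hmem
    have : PushoutI.of (φ := φ) l z ∈ (PushoutI.base φ).range := by
      rw [← PushoutI.inf_of_range_eq_base_range hφ hkl]
      exact ⟨hmem, z, rfl⟩
    obtain ⟨a, ha⟩ := this
    refine hz ⟨a, PushoutI.of_injective hφ l ?_⟩
    rw [PushoutI.of_apply_eq_base, ha]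
  rintro ⟨k, h1, h2⟩
  by_cases hki : k = i
  · exact key k j y hy (hki ▸ hij) h2
  · exact key k i x hx hki h1

theorem IsNormal.isReduced (hφ : ∀ i, Function.Injective (φ i)) {n : ℕ} {g : Fin n → Σ i, G i}
    (h : IsNormal φ (List.ofFn g)) :
    IsReduced φ fun k => PushoutI.of (φ := φ) (g k).1 (g k).2 := by
  intro k l hkl
  rcases h with h | ⟨h1, h2⟩
  · rw [List.length_ofFn] at h
    omega
  · refine not_multipliable φ hφ ?_ (h1 _ (List.mem_ofFn.2 ⟨k, rfl⟩))
      (h1 _ (List.mem_ofFn.2 ⟨l, rfl⟩))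
    have := List.isChain_iff_getElem.1 h2 k (by simp [hkl])
    simpa [hkl] using this

variable [∀ i, MetricSpace (G i)]

theorem letterDist_nonneg (x y : PushoutI φ) : 0 ≤ letterDist φ x y := by
  rw [letterDist]
  split_ifs
  · refine Real.sInf_nonneg ?_
    rintro _ ⟨i, g, h, -, -, rfl⟩
    exact dist_nonneg
  · refine Real.sInf_nonneg ?_
    rintro _ ⟨i, j, g, h, a, -, -, rfl⟩
    positivity

theorem rho_nonneg {n : ℕ} (α β : Fin n → PushoutI φ) : 0 ≤ rho φ α β :=
  Finset.sum_nonneg fun _ _ => letterDist_nonneg φ _ _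

variable {φ} in
theorem exists_foldBound [Nonempty ι] (f : PushoutI φ) : ∃ c, FoldBound φ f c := by
  induction f using PushoutI.induction_on with
  | of i g => exact ⟨_, foldBound_of g⟩
  | base a =>
    obtain ⟨i⟩ := ‹Nonempty ι›
    exact ⟨_, PushoutI.of_apply_eq_base φ i a ▸ foldBound_of (φ i a)⟩
  | mul x y hx hy =>
    obtain ⟨c, hc⟩ := hx
    obtain ⟨d, hd⟩ := hy
    exact ⟨_, hc.mul hd⟩

variable [∀ i, IsIsometricSMul (G i)ᵐᵒᵖ (G i)]

/-- A nonempty normal list that folds up gives a symmetric reduced pair. -/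
theorem exists_pair_of_isNormal (hφ : ∀ i, Function.Injective (φ i))
    (hagree : ∀ i j a b, dist (φ i a) (φ i b) = dist (φ j a) (φ j b))
    {w : List (Σ i, G i)} {c : ℝ} (hw : FoldCost w c) (hn : IsNormal φ w) (hne : w ≠ []) :
    ∃ p ∈ symmetricReducedPairs φ (value φ w), rho φ p.2.1 p.2.2 ≤ c := by
  obtain ⟨l, hl, rfl, -, hc⟩ := hw.exists_labelled 0
  obtain ⟨m, g, rfl⟩ : ∃ (m : ℕ) (g : Fin (m + 1) → Entry G), l = List.ofFn g := by
    obtain _ | ⟨e, l⟩ := l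
    · exact absurd rfl hne
    · exact ⟨l.length, (e :: l).get, (List.ofFn_get _).symm⟩
  set α : Fin (m + 1) → PushoutI φ := fun k => PushoutI.of (g k).idx (g k).x with hα
  set ζ : Fin (m + 1) → PushoutI φ := fun k => PushoutI.of (g k).idx (g k).z with hζ
  have hval : value φ ((List.ofFn g).map fun e => (⟨e.idx, e.x⟩ : Σ i, G i)) = eval α := by
    rw [value, List.map_map, List.map_ofFn]
    rfl
  have hred : IsReduced φ α := by
    rw [List.map_ofFn] at hn
    exact hn.isReduced φ hφ
  have hL : Noncrossing fun k => (g k).lab := by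
    intro a b c d hab hbc hcd hac hbd
    simp only at hac hbd ⊢
    by_contra hne
    refine hl.noncrossing _ _ hne ?_
    have h1 : [a, b, c, d].Sublist (List.finRange (m + 1)) := by
      have hlt : [a, b, c, d].Pairwise (· < ·) := by
        simp only [List.pairwise_cons, List.mem_cons, List.not_mem_nil, or_false]
        refine ⟨?_, ?_, ?_, by simp, .nil⟩
        · rintro _ (rfl | rfl | rfl)
          exacts [hab, hab.trans hbc, (hab.trans hbc).trans hcd]
        · rintro _ (rfl | rfl)
          exacts [hbc, hbc.trans hcd]
        · rintro _ rfl
          exact hcd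
      exact List.sublist_of_subperm_of_pairwise
        (List.subperm_of_subset (hlt.imp fun h => h.ne) fun x _ => List.mem_finRange x)
        hlt (List.pairwise_lt_finRange _)
    have h2 := h1.map fun k => (g k).lab
    rw [List.ofFn_eq_map, List.map_map]
    simp only [List.map_cons, List.map_nil] at h2
    rwa [← hac, ← hbd] at h2
  have hsym : IsSymmetricPair φ (eval α) α ζ := by
    refine hL.isSymmetricPair (fun k => (g k).idx) (fun k => ⟨_, rfl⟩) (fun k => ⟨_, rfl⟩) ?_ ?_
    · intro k l hkl hlab
      have h1 := List.pairwise_ofFn.1 hl.pairwise hkl hlab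
      exact ⟨h1.1, by rw [hα, hζ]; simp only [h1.2]⟩
    · intro b
      have h1 := hl.prod_filter φ b
      rw [List.ofFn_eq_map, List.filter_map, List.map_map] at h1
      rw [evalOn_filter]
      exact h1
  rw [hval]
  refine ⟨⟨m + 1, α, ζ⟩, ⟨hsym, ⟨m.succ_pos, fun k => ⟨_, _, rfl⟩⟩, hred, rfl⟩, ?_⟩
  rw [List.map_ofFn, List.sum_ofFn] at hc
  refine le_of_eq_of_le (Finset.sum_congr rfl fun k _ => ?_) hc
  exact letterDist_of φ hφ hagree _ _ _

variable [∀ i, IsIsometricSMul (G i) (G i)]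

theorem FoldBound.exists_pair [Nonempty ι] (hφ : ∀ i, Function.Injective (φ i))
    (hagree : ∀ i j a b, dist (φ i a) (φ i b) = dist (φ j a) (φ j b))
    {f : PushoutI φ} {c : ℝ} (h : FoldBound φ f c) :
    ∃ p ∈ symmetricReducedPairs φ f, rho φ p.2.1 p.2.2 ≤ c := by
  obtain ⟨w, rfl, hw⟩ := h
  obtain ⟨w', h1, h2, h3⟩ := hw.exists_isNormal φ hagree _ le_rfl
  rw [← h2]
  by_cases hne : w' = []
  · subst hne
    obtain ⟨i⟩ := ‹Nonempty ι›
    -- Words are nonempty, so the empty normal list is replaced by the single letter 1.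
    have h4 : FoldCost [(⟨i, 1⟩ : Σ i, G i)] c :=
      (FoldCost.single (1 : G i)).mono (by simpa using h3.nonneg)
    simpa using exists_pair_of_isNormal φ hφ hagree h4 (.inl le_rfl) (by simp)
  · exact exists_pair_of_isNormal φ hφ hagree h3 h1 hne

theorem isGLB_graevNorm [Nonempty ι] (hφ : ∀ i, Function.Injective (φ i))
    (hagree : ∀ i j a b, dist (φ i a) (φ i b) = dist (φ j a) (φ j b)) (f : PushoutI φ) :
    IsGLB ((fun p : WordPair (PushoutI φ) => rho φ p.2.1 p.2.2) '' symmetricReducedPairs φ f)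
      (graevNorm φ f) ∧ (symmetricReducedPairs φ f).Nonempty := by
  have hkey : ∀ {n : ℕ} (α β : Fin n → PushoutI φ), IsWord φ α → IsWord φ β → eval α = f →
      eval β = 1 → ∀ ε > 0, ∃ p ∈ symmetricReducedPairs φ f,
        rho φ p.2.1 p.2.2 ≤ rho φ α β + ε := by
    rintro n α β hα hβ rfl hβ1 ε hε
    have hn : (0 : ℝ) < n := by exact_mod_cast hα.1
    -- Each of the `n` letters may lose `ε / n`.
    have := foldBound_rho hφ hagree (div_pos hε hn) α β hα.2 hβ.2
    rw [hβ1, inv_one, mul_one, mul_div_cancel₀ _ hn.ne'] at this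
    exact this.exists_pair φ hφ hagree
  have hne : (symmetricReducedPairs φ f).Nonempty := by
    obtain ⟨c, hc⟩ := exists_foldBound f
    obtain ⟨p, hp, -⟩ := hc.exists_pair φ hφ hagree
    exact ⟨p, hp⟩
  refine ⟨⟨?_, ?_⟩, hne⟩
  · rintro _ ⟨⟨n, α, ξ⟩, ⟨⟨T, ⟨⟨h1, h2, h3, h4⟩, -⟩, -⟩, -⟩, rfl⟩
    refine csInf_le ⟨0, ?_⟩ ⟨n, α, ξ, h1, h2, h3, h4, rfl⟩
    rintro _ ⟨n, α, β, -, -, -, -, rfl⟩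
    exact rho_nonneg φ α β
  · intro b hb
    refine le_csInf ?_ ?_
    · obtain ⟨⟨n, α, ξ⟩, ⟨T, ⟨⟨h1, h2, h3, h4⟩, -⟩, -⟩, -⟩ := hne
      exact ⟨_, n, α, ξ, h1, h2, h3, h4, rfl⟩
    · rintro _ ⟨n, α, β, h1, h2, h3, h4, rfl⟩
      refine le_of_forall_pos_le_add fun ε hε => ?_
      obtain ⟨p, hp, hle⟩ := hkey α β h1 h2 h3 h4 ε hε
      exact (hb ⟨p, hp, rfl⟩).trans hle

end ReducedPairs


/-! ### Arbitrary slim trees and the letters of symmetric pairs -/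

section SlimTrees

variable {ι A : Type*} {G : ι → Type*} [Group A] [∀ i, Group (G i)] {φ : ∀ i, A →* G i}
  {n : ℕ} {ζ : Fin n → PushoutI φ} {T : IntervalTree n}

theorem Tree.Below.ne_root {T : Tree} {s t : T.Node} (h : T.Below s t) : s ≠ T.root := by
  rintro rfl
  obtain ⟨hne, k, hk⟩ := h
  exact hne (by rw [← hk, T.iterate_root])

theorem IsEvaluationTree.subset_of_below (h : IsEvaluationTree φ ζ T) {s t : T.Node}
    (hst : T.Below s t) : T.I s ⊆ T.I t := by
  by_cases ht : t = T.root
  · rw [ht, h.root_interval]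
    exact Finset.subset_univ _
  · obtain ⟨h1, h2⟩ := h.strict s t hst ht
    exact Finset.Icc_subset_Icc h1.le h2.le

theorem IsEvaluationTree.ssubset_of_below (h : IsEvaluationTree φ ζ T) {s t : T.Node}
    (hst : T.Below s t) (ht : t ≠ T.root) : T.I s ⊂ T.I t := by
  refine ⟨h.subset_of_below hst, fun hle => ?_⟩
  have h1 := Finset.mem_Icc.1 (hle (Finset.mem_Icc.2 ⟨le_rfl, T.lo_le_hi t⟩))
  exact absurd h1.1 (not_le.2 (h.strict s t hst ht).1)

theorem IsEvaluationTree.below_or_below (h : IsEvaluationTree φ ζ T) {s t : T.Node}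
    (hst : (T.I s ∩ T.I t).Nonempty) : T.Below s t ∨ s = t ∨ T.Below t s := by
  rcases le_total (T.height t) (T.height s) with hle | hle
  · rcases h.order s t hle hst with h | h
    exacts [.inl h, .inr (.inl h)]
  · rcases h.order t s hle (by rwa [Finset.inter_comm]) with h | h
    exacts [.inr (.inr h), .inr (.inl h.symm)]

/-- Descend through nodes whose intervals contain `k`. Below the root the intervals shrink strictly,
so this stops; the root is treated apart because `strict` does not apply to it. -/
theorem IsEvaluationTree.exists_mem_R (h : IsEvaluationTree φ ζ T) (k : Fin n) :
    ∃ t, k ∈ T.R t := by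
  have key : ∀ (N : ℕ) (s : T.Node), (T.I s).card = N → s ≠ T.root → k ∈ T.I s →
      ∃ t, k ∈ T.R t := by
    intro N
    induction N using Nat.strong_induction_on with
    | _ N ih =>
      rintro s rfl hs hk
      by_cases hR : k ∈ T.R s
      · exact ⟨s, hR⟩
      · have : ∃ r, T.Below r s ∧ k ∈ T.I r := by
          by_contra hno
          exact hR ⟨hk, fun r hr hkr => hno ⟨r, hr, hkr⟩⟩
        obtain ⟨r, hr, hkr⟩ := this
        exact ih _ (Finset.card_lt_card (h.ssubset_of_below hr hs)) r rfl hr.ne_root hkr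
  by_cases hR : k ∈ T.R T.root
  · exact ⟨_, hR⟩
  · have : ∃ r, T.Below r T.root ∧ k ∈ T.I r := by
      by_contra hno
      exact hR ⟨by simp [h.root_interval], fun r hr hkr => hno ⟨r, hr, hkr⟩⟩
    obtain ⟨r, hr, hkr⟩ := this
    exact key _ r rfl hr.ne_root hkr

/-- Cut out a largest interval contained in `J`: it has value 1, and any interval in `J` covering a
remaining position is disjoint from it, by nesting and maximality. When no interval is left, all
letters are 1. -/
theorem IsSlimTree.evalOn_eq_one (h : IsSlimTree φ ζ T) (J : Finset (Fin n))
    (hJ : ∀ k ∈ J, ζ k = 1 ∨ ∃ s, k ∈ T.I s ∧ T.I s ⊆ J) : evalOn ζ J = 1 := by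
  induction J using Finset.strongInduction with
  | H J ih =>
    by_cases hs : ∃ s, T.I s ⊆ J
    · have hfin : {F | ∃ s, T.I s = F ∧ F ⊆ J}.Finite := Set.toFinite _
      obtain ⟨s₀, hs₀⟩ := hs
      obtain ⟨_, ⟨s, rfl, hsJ⟩, hmax⟩ := Set.exists_max_image _ Finset.card hfin ⟨_, s₀, rfl, hs₀⟩
      set J₁ := J.filter (· < T.lo s)
      set J₂ := J.filter (T.hi s < ·)
      have hdec : J = J₁ ∪ (T.I s ∪ J₂) := by
        ext k
        simp only [J₁, J₂, Finset.mem_union, Finset.mem_filter]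
        constructor
        · intro hk
          rcases lt_or_ge k (T.lo s) with h1 | h1
          · exact .inl ⟨hk, h1⟩
          rcases lt_or_ge (T.hi s) k with h2 | h2
          · exact .inr (.inr ⟨hk, h2⟩)
          · exact .inr (.inl (Finset.mem_Icc.2 ⟨h1, h2⟩))
        · rintro (h | h | h)
          exacts [h.1, hsJ h, h.1]
      have hout : ∀ k, k ∈ J₁ ∪ J₂ ↔ k ∈ J ∧ k ∉ T.I s := by
        intro k
        simp only [J₁, J₂, Finset.mem_union, Finset.mem_filter, IntervalTree.I, Finset.mem_Icc,
          not_and_or, not_le]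
        tauto
      have hlo : T.lo s ∈ T.I s := Finset.mem_Icc.2 ⟨le_rfl, T.lo_le_hi s⟩
      have hlt : J₁ ∪ J₂ ⊂ J :=
        ⟨fun k hk => ((hout k).1 hk).1, fun hle => ((hout _).1 (hle (hsJ hlo))).2 hlo⟩
      rw [hdec, evalOn_union, evalOn_union, h.2, one_mul, ← evalOn_union]
      · refine ih _ hlt fun k hk => ?_
        obtain ⟨hkJ, hks⟩ := (hout k).1 hk
        rcases hJ k hkJ with h1 | ⟨r, hkr, hrJ⟩
        · exact .inl h1
        · refine .inr ⟨r, hkr, fun x hx => (hout x).2 ⟨hrJ hx, fun hxs => ?_⟩⟩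
          rcases h.1.below_or_below ⟨x, Finset.mem_inter.2 ⟨hx, hxs⟩⟩ with hb | rfl | hb
          · exact hks (h.1.subset_of_below hb hkr)
          · exact hks hkr
          · refine absurd (hmax _ ⟨r, rfl, hrJ⟩) (not_le.2 (Finset.card_lt_card ?_))
            exact ⟨h.1.subset_of_below hb, fun hle => hks (hle hkr)⟩
      · intro x hx y hy
        exact ((Finset.mem_filter.1 hx).2.trans_le (T.lo_le_hi s)).trans (Finset.mem_filter.1 hy).2
      · intro x hx y hy
        exact (Finset.mem_Icc.1 hx).2.trans_lt (Finset.mem_filter.1 hy).2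
      · intro x hx y hy
        have h1 := (Finset.mem_filter.1 hx).2
        rcases Finset.mem_union.1 hy with hy | hy
        · exact h1.trans_le (Finset.mem_Icc.1 hy).1
        · exact (h1.trans_le (T.lo_le_hi s)).trans (Finset.mem_filter.1 hy).2
    · rw [evalOn_congr (β := fun _ => 1)]
      · simp [evalOn]
      · intro k hk
        exact (hJ k hk).resolve_right fun ⟨s, _, hsJ⟩ => hs ⟨s, hsJ⟩

/-- If at a node of a slim tree all letters but one are trivial, then so is this one. -/
theorem IsSlimTree.eq_one (h : IsSlimTree φ ζ T) {t : T.Node} {k : Fin n} (hk : k ∈ T.R t)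
    (hR : ∀ l ∈ T.R t, l ≠ k → ζ l = 1) : ζ k = 1 := by
  -- Here `p` is one side of `k`. An interval below `t` misses `k`, hence stays on one side, so each
  -- side has value 1 and `ζ k` is all that remains of the value of `T.I t`.
  have hside : ∀ (p : Fin n → Prop) [DecidablePred p], ¬ p k →
      (∀ x y, p x → ¬ p y → y ≠ k → (x < k ∧ k < y) ∨ (y < k ∧ k < x)) →
      evalOn ζ ((T.I t).filter p) = 1 := by
    intro p _ hp2 hp3
    refine h.evalOn_eq_one _ fun x hx => ?_
    obtain ⟨hxI, hxp⟩ := Finset.mem_filter.1 hx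
    by_cases hxR : x ∈ T.R t
    · exact .inl (hR x hxR fun hxk => hp2 (hxk ▸ hxp))
    · have : ∃ r, T.Below r t ∧ x ∈ T.I r := by
        by_contra hno
        exact hxR ⟨hxI, fun r hr hkr => hno ⟨r, hr, hkr⟩⟩
      obtain ⟨r, hr, hxr⟩ := this
      have hkr := hk.2 r hr
      refine .inr ⟨r, hxr, fun y hy => Finset.mem_filter.2 ⟨h.1.subset_of_below hr hy, ?_⟩⟩
      by_contra hyp
      have hyk : y ≠ k := fun h => hkr (h ▸ hy)
      have h1 := Finset.mem_Icc.1 hxr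
      have h2 := Finset.mem_Icc.1 hy
      rcases hp3 x y hxp hyp hyk with h3 | h3
      · exact hkr (Finset.mem_Icc.2 ⟨h1.1.trans h3.1.le, h3.2.le.trans h2.2⟩)
      · exact hkr (Finset.mem_Icc.2 ⟨h2.1.trans h3.1.le, h3.2.le.trans h1.2⟩)
  have h1 := hside (· < k) (lt_irrefl k)
    fun x y hx hy hne => .inl ⟨hx, lt_of_le_of_ne (not_lt.1 hy) hne.symm⟩
  have h2 := hside (k < ·) (lt_irrefl k)
    fun x y hx hy hne => .inr ⟨lt_of_le_of_ne (not_lt.1 hy) hne, hx⟩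
  have hdec : T.I t = (T.I t).filter (· < k) ∪ ({k} ∪ (T.I t).filter (k < ·)) := by
    ext x
    simp only [Finset.mem_union, Finset.mem_filter, Finset.mem_singleton]
    constructor
    · intro hx
      rcases lt_trichotomy x k with h | h | h
      exacts [.inl ⟨hx, h⟩, .inr (.inl h), .inr (.inr ⟨hx, h⟩)]
    · rintro (h | rfl | h)
      exacts [h.1, hk.1, h.1]
  have h3 := h.2 t
  rw [hdec, evalOn_union, evalOn_union, h1, h2, evalOn_singleton, one_mul, mul_one] at h3
  · exact h3
  · intro x hx y hy
    rw [Finset.mem_singleton.1 hx]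
    exact (Finset.mem_filter.1 hy).2
  · intro x hx y hy
    have h1 := (Finset.mem_filter.1 hx).2
    rcases Finset.mem_union.1 hy with hy | hy
    · rwa [Finset.mem_singleton.1 hy]
    · exact h1.trans (Finset.mem_filter.1 hy).2

/-- The letters of the second word of a symmetric pair are built from the first word. -/
theorem IsSymmetricPair.letter {f : PushoutI φ} {α : Fin n → PushoutI φ}
    (h : IsSymmetricPair φ f α ζ) (k : Fin n) :
    ζ k = 1 ∨ ζ k = α k ∨ ∃ F : Finset (Fin n),
      ζ k = (evalOn α (F.filter (· < k)))⁻¹ * (evalOn α (F.filter (k < ·)))⁻¹ := by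
  obtain ⟨T, -, hT, hsym⟩ := h
  obtain ⟨t, ht⟩ := hT.1.exists_mem_R k
  obtain ⟨F, ⟨hF1, hF2, -⟩, j, hj, hζ⟩ := hsym t
  by_cases hk1 : ζ k = 1
  · exact .inl hk1
  right
  have hkF := hF2 k ht hk1
  by_cases hcard : F.card = 1
  · obtain ⟨x, rfl⟩ := Finset.card_eq_one.1 hcard
    obtain rfl := Finset.mem_singleton.1 hkF
    -- With one admissible position symmetrization imposes nothing, but then `ζ k` is the only
    -- possibly nontrivial letter at its node, so it is 1.
    refine absurd (hT.eq_one ht fun l hl hne => ?_) hk1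
    by_contra hl1
    exact hne (Finset.mem_singleton.1 (hF2 l hl hl1))
  · have := congrFun hζ k
    rw [symmetrization, if_neg hcard] at this
    by_cases hkj : k = j
    · subst hkj
      exact .inr ⟨F, by simpa using this⟩
    · exact .inl (by simpa [hkj, hkF] using this)

end SlimTrees

/-! ### Trivial amalgamated subgroup: uniqueness and finiteness -/

section TrivialAmalgam

variable {ι A : Type*} {G : ι → Type*} [Group A] [∀ i, Group (G i)] {φ : ∀ i, A →* G i}

/-- The letter 1 is multipliable with every letter, so it occurs in a reduced form only as the sole
letter. All other reduced forms are nonempty reduced words of the free product, to which the amalgam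
maps when `A` is trivial. -/
theorem IsReducedForm.exists_word [Subsingleton A] {f : PushoutI φ} {n : ℕ}
    {α : Fin n → PushoutI φ} (h : IsReducedForm φ f α) :
    (f = 1 ∧ List.ofFn α = [1]) ∨ ∃ w : CoprodI.Word G, w ≠ .empty ∧
      w.prod = PushoutI.lift (φ := φ) (fun i => CoprodI.of) 1
        (fun i => by ext a; simp [Subsingleton.elim a 1]) f ∧
      List.ofFn α = w.toList.map fun s => PushoutI.of s.1 s.2 := by
  obtain ⟨⟨hn, hletter⟩, hred, rfl⟩ := h
  choose i hi using hletter
  choose g hg using hi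
  obtain rfl : α = fun k => PushoutI.of (i k) (g k) := funext fun k => (hg k).symm
  by_cases h1 : ∃ k, (PushoutI.of (i k) (g k) : PushoutI φ) = 1
  · obtain ⟨k, hk⟩ := h1
    have hmul : ∀ l, Multipliable φ (PushoutI.of (i k) (g k)) (PushoutI.of (i l) (g l)) ∧
        Multipliable φ (PushoutI.of (i l) (g l)) (PushoutI.of (i k) (g k)) := fun l =>
      ⟨⟨i l, hk ▸ one_mem _, g l, hg l⟩, ⟨i l, ⟨g l, hg l⟩, hk ▸ one_mem _⟩⟩
    have hn1 : n = 1 := by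
      by_contra hne
      rcases Nat.lt_or_ge (k + 1) n with hlt | hge
      · exact hred k ⟨k + 1, hlt⟩ rfl (hmul _).1
      · exact hred ⟨k - 1, by omega⟩ k (by simp; omega) (hmul _).2
    subst hn1
    obtain rfl := Subsingleton.elim k 0
    left
    simp [eval, hk]
  · right
    push Not at h1
    refine ⟨⟨List.ofFn fun k => ⟨i k, g k⟩, ?_, ?_⟩, ?_, ?_, ?_⟩
    · intro s hs
      obtain ⟨k, rfl⟩ := List.mem_ofFn.1 hs
      intro hgk
      refine h1 k ?_
      simp only at hgk
      rw [hgk, map_one]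
    · rw [List.isChain_iff_getElem]
      intro k hk
      simp only [List.length_ofFn] at hk
      simp only [List.getElem_ofFn]
      intro hik
      exact hred ⟨k, by omega⟩ ⟨k + 1, hk⟩ rfl
        ⟨_, ⟨_, hg _⟩, by rw [hik]; exact ⟨_, hg _⟩⟩
    · intro h
      have := congrArg (fun w => w.toList.length) h
      simp [CoprodI.Word.empty] at this
      omega
    · rw [eval, map_list_prod, CoprodI.Word.prod, List.map_ofFn, List.map_ofFn]
      congr 1
    · rw [List.map_ofFn]
      rfl

theorem IsReducedForm.unique [Subsingleton A] {f : PushoutI φ} {α β : Word (PushoutI φ)}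
    (hα : IsReducedForm φ f α.2) (hβ : IsReducedForm φ f β.2) : α = β := by
  classical
  have hinj : Function.Injective (CoprodI.Word.prod (M := G)) := CoprodI.Word.equiv.symm.injective
  obtain ⟨n, α⟩ := α
  obtain ⟨m, β⟩ := β
  rw [← List.ofFn_inj']
  rcases hα.exists_word with ⟨h1, h2⟩ | ⟨w, h1, h2, h3⟩ <;>
    rcases hβ.exists_word with ⟨h1', h2'⟩ | ⟨w', h1', h2', h3'⟩
  · exact h2.trans h2'.symm
  · rw [h1, map_one] at h2'
    exact absurd (hinj h2') h1'
  · rw [h1', map_one] at h2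
    exact absurd (hinj h2) h1
  · rw [← h2'] at h2
    obtain rfl := hinj h2
    exact h3.trans h3'.symm

/-- The first word is determined by `f`, and `IsSymmetricPair.letter` leaves finitely many choices
for each letter of the second. -/
theorem finite_symmetricReducedPairs [Subsingleton A] (f : PushoutI φ) :
    (symmetricReducedPairs φ f).Finite := by
  rcases (symmetricReducedPairs φ f).eq_empty_or_nonempty with h | ⟨⟨n, α, ξ⟩, hp⟩
  · rw [h]
    exact Set.finite_empty
  have hfin : ({ζ : Fin n → PushoutI φ | ∀ k, ζ k = 1 ∨ ζ k = α k ∨ ∃ F : Finset (Fin n),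
      ζ k = (evalOn α (F.filter (· < k)))⁻¹ * (evalOn α (F.filter (k < ·)))⁻¹}).Finite := by
    refine Set.Finite.subset (Set.Finite.pi' (t := fun k => ({1, α k} : Set (PushoutI φ)) ∪
      Set.range fun F : Finset (Fin n) =>
        (evalOn α (F.filter (· < k)))⁻¹ * (evalOn α (F.filter (k < ·)))⁻¹)
      fun k => (Set.toFinite _).union (Set.finite_range _)) ?_
    intro ζ hζ k
    rcases hζ k with h | h | ⟨F, h⟩
    · exact .inl (.inl h)
    · exact .inl (.inr h)
    · exact .inr ⟨F, h.symm⟩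
  refine (hfin.image fun ζ => (⟨n, α, ζ⟩ : WordPair (PushoutI φ))).subset ?_
  rintro ⟨m, β, ζ⟩ hq
  have := IsReducedForm.unique (α := ⟨m, β⟩) (β := ⟨n, α⟩) hq.2 hp.2
  cases this
  exact ⟨ζ, hq.1.letter, rfl⟩

end TrivialAmalgam


end Graev

end


open Graev in
/-- The Graev norm of `f` is the infimum of `ρ` over the symmetric reduced `f`-pairs.  If `A` is
trivial, then `f` has exactly one reduced form, there are only finitely many symmetric reduced
`f`-pairs, the Graev norm is attained at one of them, and the letters of their second words are
built from the letters of `f` in the way stated. -/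
theorem mainTheorem3 {ι A : Type*} {G : ι → Type*} [Nonempty ι] [Group A] [∀ i, Group (G i)]
    [∀ i, MetricSpace (G i)] [∀ i, IsIsometricSMul (G i) (G i)]
    [∀ i, IsIsometricSMul (G i)ᵐᵒᵖ (G i)] (φ : ∀ i, A →* G i)
    (hφ : ∀ i, Function.Injective (φ i)) (hclosed : ∀ i, IsClosed (Set.range (φ i)))
    (hagree : ∀ i j a b, dist (φ i a) (φ i b) = dist (φ j a) (φ j b)) (f : PushoutI φ) :
    IsGLB ((fun p : WordPair (PushoutI φ) => rho φ p.2.1 p.2.2) '' symmetricReducedPairs φ f)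
      (graevNorm φ f) ∧
    (Subsingleton A →
      (∃! α : Word (PushoutI φ), IsReducedForm φ f α.2) ∧
      (symmetricReducedPairs φ f).Finite ∧
      IsLeast ((fun p : WordPair (PushoutI φ) => rho φ p.2.1 p.2.2) '' symmetricReducedPairs φ f)
        (graevNorm φ f) ∧
      ∀ p ∈ symmetricReducedPairs φ f, ∀ k : Fin p.1,
        p.2.2 k = 1 ∨ p.2.2 k = p.2.1 k ∨
        ∃ F : Finset (Fin p.1), p.2.2 k =
          (evalOn p.2.1 (F.filter (· < k)))⁻¹ * (evalOn p.2.1 (F.filter (k < ·)))⁻¹) := by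
  obtain ⟨hglb, hne⟩ := isGLB_graevNorm φ hφ hagree f
  refine ⟨hglb, fun _ => ?_⟩
  have hfin := finite_symmetricReducedPairs (φ := φ) f
  refine ⟨?_, hfin, ?_, fun p hp k => hp.1.letter k⟩
  · obtain ⟨⟨n, α, ξ⟩, hp⟩ := hne
    exact ⟨⟨n, α⟩, hp.2, fun β hβ => hβ.unique hp.2⟩
  · obtain ⟨p, hp, hmin⟩ := Set.exists_min_image _
      (fun p : WordPair (PushoutI φ) => rho φ p.2.1 p.2.2) hfin hne
    have : IsLeast ((fun p : WordPair (PushoutI φ) => rho φ p.2.1 p.2.2) ''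
        symmetricReducedPairs φ f) (rho φ p.2.1 p.2.2) :=
      ⟨⟨p, hp, rfl⟩, by rintro _ ⟨q, hq, rfl⟩; exact hmin q hq⟩
    rwa [hglb.unique this.isGLB]
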